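/- Let $T^r=(S^1)^r$. A linear action of $T^r$ on $\mathbb C^n$ is a continuous homomorphism $\rho:T^r\to GL(n,\mathbb C)$. For $\mathbf k\in\mathbb Z^r$ put $\lambda^{\mathbf k}=\lambda_1^{k_1}\cdots\lambda_r^{k_r}$ and let $$V_{\mathbf k}(\rho)=\{\varphi\in\mathbb C[z_1,\dots,z_n]:\ \varphi(\rho(\lambda)z)=\lambda^{\mathbf k}\varphi(z)\ \text{ for all }\lambda\in T^r,\ z\in\mathbb C^n\}.$$ If $V_{\mathbf k}(\rho)\neq 0$, let $d_{\mathbf k}(\rho)$ and $D_{\mathbf k}(\rho)$ be the minimum and the maximum of the degrees of its nonzero elements (when only the constants are $\rho$-invariant entire functions on $\mathbb C^n$, $V_{\mathbf k}(\rho)$ is finite dimensional). The resonance order of $\rho$ is $\mu_\rho=\max\{D_{\mathbf k}(\rho): V_{\mathbf k}(\rho)\ne0,\ d_{\mathbf k}(\rho)=1\}$. If $\rho(\lambda)z=(\lambda^{\mathbf a_1}z_1,\dots,\lambda^{\mathbf a_n}z_n)$ in some linear coordinates on $\mathbb C^n$, with $\mathbf a_i\in\mathbb Z^r$, the $i$-th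 resonance order of $\rho$ is $\mu_i=D_{\mathbf a_i}(\rho)$. (The maximum over the empty set, which occurs only for $n=0$, is $0$.) A domain (nonempty connected open set) $D\subset\mathbb C^n$ is a quasi-Reinhardt domain with respect to $\rho$ if $\rho(\lambda)D\subset D$ for all $\lambda\in T^r$. **Theorem.** Let $\rho$ and $\rho'$ be linear actions of $T^r$ and $T^s$ on $\mathbb C^n$ such that all $\rho$-invariant and all $\rho'$-invariant entire functions on $\mathbb C^n$ are constant. Let $D$ and $D'$ be bounded quasi-Reinhardt domains with respect to $\rho$ and $\rho'$ respectively, both containing the origin, and let $f:D\to D'$ be a biholomorphism with $f(0)=0$. Then: 1. $f$ is (the restriction to $D$ of) a polynomial mapping of degree at most the quasi-resonance order $$\nu_{\rho\rho'}=\max\{D_{\mathbf k}(\rho):\ \mathbf k\in\mathbb Z^r,\ V_{\mathbf k}(\rho)\ne 0,\ d_{\mathbf k}(\rho)\le\mu_{\rho'}\}.$$ 2. More precisely, there are linear coordinates on the target $\mathbb C^n$ in which $\rho'$ is diagonal, $\rho'(\lambda)w=(\lambda^{\mathbf a'_1}w_1,\dots,\lambda^{\mathbf a'_n}w_n)$ with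 $\mathbf a'_i\in\mathbb Z^s$; and in any such coordinates, for each $1\le i\le n$, the $i$-th component $f_i$ of $f$ is a polynomial of degree at most the $i$-th quasi-resonance order $$\nu_{i\rho'}=\max\{D_{\mathbf k}(\rho):\ \mathbf k\in\mathbb Z^r,\ V_{\mathbf k}(\rho)\ne 0,\ d_{\mathbf k}(\rho)\le\mu'_i\},$$ where $\mu'_i=D_{\mathbf a'_i}(\rho')$ is the $i$-th resonance order of $\rho'$. -/

import Mathlib

open scoped Matrix

noncomputable section

namespace QuasiReinhardt

/-- The torus `T^r = (S¹)^r`. -/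
abbrev Torus (r : ℕ) : Type := Fin r → Circle

/-- A linear action of `T^r` on `ℂⁿ`: a continuous homomorphism `T^r → GL(n, ℂ)`. -/
abbrev TorusAction (r n : ℕ) : Type := Torus r →ₜ* GL (Fin n) ℂ

/-- The action of `g ∈ T^r` on a vector `z ∈ ℂⁿ`. -/
def act {r n : ℕ} (ρ : TorusAction r n) (g : Torus r) (z : Fin n → ℂ) : Fin n → ℂ :=
  (ρ g : Matrix (Fin n) (Fin n) ℂ) *ᵥ z

/-- The character `λ ↦ λ^k = λ₁^{k₁} ⋯ λ_r^{k_r}` of `T^r` indexed by `k ∈ ℤ^r`. -/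
def torusChar {r : ℕ} (k : Fin r → ℤ) (g : Torus r) : ℂ :=
  ∏ j, (g j : ℂ) ^ k j

/-- Every `ρ`-invariant holomorphic function on `ℂⁿ` is constant. -/
def OnlyConstantInvariants {r n : ℕ} (ρ : TorusAction r n) : Prop :=
  ∀ h : (Fin n → ℂ) → ℂ, Differentiable ℂ h → (∀ g z, h (act ρ g z) = h z) →
    ∃ c : ℂ, ∀ z, h z = c

/-- A quasi-Reinhardt domain with respect to `ρ`: a nonempty connected open set of `ℂⁿ`
which is `ρ`-invariant. -/
structure IsQuasiReinhardtDomain {r n : ℕ} (ρ : TorusAction r n) (D : Set (Fin n → ℂ)) :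
    Prop where
  isOpen : IsOpen D
  isConnected : IsConnected D
  invariant : ∀ g, ∀ z ∈ D, act ρ g z ∈ D

/-- `f` is (on `D`) a biholomorphism from `D` onto `D'`: it is holomorphic on `D`
and has a holomorphic two-sided inverse `D' → D`. -/
def IsBiholomorphism {n : ℕ} (f : (Fin n → ℂ) → (Fin n → ℂ)) (D D' : Set (Fin n → ℂ)) : Prop :=
  DifferentiableOn ℂ f D ∧ Set.MapsTo f D D' ∧
    ∃ F : (Fin n → ℂ) → (Fin n → ℂ),
      DifferentiableOn ℂ F D' ∧ Set.MapsTo F D' D ∧ Set.InvOn F f D D'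

/-- The weight space `V_k` of `ρ`: all polynomials `φ` on `ℂⁿ` such that
`φ(ρ(λ) z) = λ^k φ(z)` for all `λ` and `z`. -/
def weightSpace {r n : ℕ} (ρ : TorusAction r n) (k : Fin r → ℤ) :
    Submodule ℂ (MvPolynomial (Fin n) ℂ) where
  carrier := {p | ∀ g z, MvPolynomial.eval (act ρ g z) p = torusChar k g * MvPolynomial.eval z p}
  add_mem' := by
    intro p q hp hq g z
    simp only [map_add, hp g z, hq g z, mul_add]
  zero_mem' := by
    intro g z
    simp
  smul_mem' := by
    intro c p hp g z
    simp only [MvPolynomial.smul_eval, hp g z]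
    ring

/-- The degrees of the nonzero elements of `V_k`. -/
def weightDegrees {r n : ℕ} (ρ : TorusAction r n) (k : Fin r → ℤ) : Set ℕ :=
  {d | ∃ p ∈ weightSpace ρ k, p ≠ 0 ∧ p.totalDegree = d}

/-- `d_k`, the minimal degree of nonzero elements of `V_k` (only used when `V_k ≠ 0`). -/
def minDegree {r n : ℕ} (ρ : TorusAction r n) (k : Fin r → ℤ) : ℕ :=
  sInf (weightDegrees ρ k)

/-- `D_k`, the maximal degree of nonzero elements of `V_k`. -/
def maxDegree {r n : ℕ} (ρ : TorusAction r n) (k : Fin r → ℤ) : ℕ :=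
  sSup (weightDegrees ρ k)

/-- The resonance order `μ_ρ = max {D_k : d_k = 1}`. -/
def resonanceOrder {r n : ℕ} (ρ : TorusAction r n) : ℕ :=
  sSup (maxDegree ρ '' {k | weightSpace ρ k ≠ ⊥ ∧ minDegree ρ k = 1})

/-- `max {D_k : V_k ≠ 0, d_k ≤ m}`. -/
def maxDegreeOfMinLE {r n : ℕ} (ρ : TorusAction r n) (m : ℕ) : ℕ :=
  sSup (maxDegree ρ '' {k | weightSpace ρ k ≠ ⊥ ∧ minDegree ρ k ≤ m})

/-- The quasi-resonance order `ν_{ρρ'} = max {D_k : d_k ≤ μ_{ρ'}}`. -/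
def quasiResonanceOrder {r s n : ℕ} (ρ : TorusAction r n) (ρ' : TorusAction s n) : ℕ :=
  maxDegreeOfMinLE ρ (resonanceOrder ρ')

/-- `b` is a basis of `ℂⁿ` diagonalizing `ρ`, with weights `a i ∈ ℤ^r`: in the coordinates
`z_i` with respect to `b`, the action is `ρ(λ) z = (λ^{a_1} z_1, …, λ^{a_n} z_n)`. -/
def IsWeightBasis {r n : ℕ} (ρ : TorusAction r n) (b : Module.Basis (Fin n) ℂ (Fin n → ℂ))
    (a : Fin n → Fin r → ℤ) : Prop :=
  ∀ g i, act ρ g (b i) = torusChar (a i) g • b i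

/-- The `i`-th resonance order `μ_i = D_{a_i}` of an action with weights `a`. -/
def resonanceOrderAt {r n : ℕ} (ρ : TorusAction r n) (a : Fin n → Fin r → ℤ) (i : Fin n) : ℕ :=
  maxDegree ρ (a i)

/-- The `i`-th quasi-resonance order `ν_{iρ'} = max {D_k : d_k ≤ μ'_i}` of `ρ` and `ρ'`, where
`a'` are the weights of `ρ'` and `μ'_i` is the `i`-th resonance order of `ρ'`. -/
def quasiResonanceOrderAt {r s n : ℕ} (ρ : TorusAction r n) (ρ' : TorusAction s n)
    (a' : Fin n → Fin s → ℤ) (i : Fin n) : ℕ :=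
  maxDegreeOfMinLE ρ (resonanceOrderAt ρ' a' i)

end QuasiReinhardt

end

/-! In weight coordinates both actions are diagonal, and a monomial `x^α` is a joint eigenfunction
of weight `wt a α`. If only constants are invariant, then `wt a α = 0` forces `α = 0`, so by
Dickson's lemma each weight is carried by finitely many monomials. Hence each weight component
(torus average against a character) of a holomorphic function on an invariant domain containing the
origin is a polynomial. On a bounded invariant domain, integrating against a conjugate monomial sees
only the component of that monomial's weight.

Let `F` be the inverse of `f`, and let `m` bound the degrees of all monomials on the target with the
weight of `y^γ`. Changing variables, the pairing of `f^γ · jac f` with `x^β` on the source is the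
conjugate of the pairing of `F^β · jac F` with `y^γ` on the target. Since `F 0 = 0`, the function
`F^β · jac F` vanishes to order `|β|` at the origin, while its component of the weight of `y^γ` only
contains monomials of degree at most `m`. So the pairing is zero once `|β| > m`. If every monomial
of some weight on the source has degree above `m`, the component of `f^γ · jac f` of that weight is
orthogonal to its own monomials, hence zero. Finitely many weights survive, and `f^γ · jac f` is a
polynomial (`exists_polynomial_mono_comp_mul_jac`).

Taking `γ = 0`, `m = 0` shows that `jac f` is a nonzero constant; taking `γ = e_i` then makes `f_i`
a polynomial whose monomials have weights `k` with `d_k ≤ m` (`exists_polynomial_component`). The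
lemma `weightDegrees_eq` identifies degrees in `V_k` with degrees of monomials of weight `k`, which
turns this into the stated bounds. -/

noncomputable section

open MeasureTheory Set Filter Topology Metric MvPolynomial

namespace QuasiReinhardt

/-! ### Characters of the torus -/

section Characters

variable {r : ℕ}

lemma torusChar_zero (g : Torus r) : torusChar 0 g = 1 := by simp [torusChar]

lemma torusChar_add (k l : Fin r → ℤ) (g : Torus r) :
    torusChar (k + l) g = torusChar k g * torusChar l g := by
  simp [torusChar, zpow_add₀, Finset.prod_mul_distrib]

lemma torusChar_neg (k : Fin r → ℤ) (g : Torus r) :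
    torusChar (-k) g = (torusChar k g)⁻¹ := by
  simp [torusChar, Finset.prod_inv_distrib]

lemma torusChar_mul (k : Fin r → ℤ) (g h : Torus r) :
    torusChar k (g * h) = torusChar k g * torusChar k h := by
  simp [torusChar, mul_zpow, Finset.prod_mul_distrib]

lemma torusChar_one (k : Fin r → ℤ) : torusChar k 1 = 1 := by simp [torusChar]

lemma norm_torusChar (k : Fin r → ℤ) (g : Torus r) : ‖torusChar k g‖ = 1 := by
  simp only [torusChar, norm_prod, norm_zpow, Circle.norm_coe, one_zpow, Finset.prod_const_one]

lemma torusChar_ne_zero (k : Fin r → ℤ) (g : Torus r) : torusChar k g ≠ 0 := by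
  rw [← norm_ne_zero_iff, norm_torusChar]; exact one_ne_zero

lemma conj_torusChar (k : Fin r → ℤ) (g : Torus r) :
    (starRingEnd ℂ) (torusChar k g) = torusChar (-k) g := by
  rw [torusChar_neg, Complex.inv_def, Complex.normSq_eq_norm_sq, norm_torusChar]; simp

lemma torusChar_sum {ι : Type*} (s : Finset ι) (k : ι → Fin r → ℤ) (g : Torus r) :
    torusChar (∑ i ∈ s, k i) g = ∏ i ∈ s, torusChar (k i) g := by
  classical
  induction s using Finset.induction_on with
  | empty => simp [torusChar_zero]
  | insert i s hi ih => rw [Finset.sum_insert hi, Finset.prod_insert hi, torusChar_add, ih]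

lemma torusChar_nsmul (m : ℕ) (k : Fin r → ℤ) (g : Torus r) :
    torusChar (m • k) g = torusChar k g ^ m := by
  induction m with
  | zero => simp [torusChar_zero]
  | succ m ih => rw [succ_nsmul, torusChar_add, ih, pow_succ]

@[fun_prop]
lemma continuous_torusChar (k : Fin r → ℤ) : Continuous (torusChar k) := by
  unfold torusChar
  refine continuous_finsetProd _ fun j _ => ?_
  refine Continuous.zpow₀ (continuous_subtype_val.comp (continuous_apply j)) _ fun g => ?_
  exact Or.inl (Circle.coe_ne_zero _)

lemma exists_torusChar_ne_one {k : Fin r → ℤ} (hk : k ≠ 0) : ∃ g : Torus r, torusChar k g ≠ 1 := by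
  classical
  obtain ⟨j, hj⟩ := Function.ne_iff.mp hk
  rw [Pi.zero_apply] at hj
  -- Only the `j`-th coordinate moves, by the angle `π / k j`, which makes the character equal to
  -- `-1`.
  refine ⟨Function.update 1 j (Circle.exp (Real.pi / k j)), ?_⟩
  have : torusChar k (Function.update 1 j (Circle.exp (Real.pi / k j))) = -1 := by
    rw [torusChar, Finset.prod_eq_single j]
    · rw [Function.update_self, Circle.coe_exp, ← Complex.exp_int_mul]
      have hj' : (k j : ℂ) ≠ 0 := by exact_mod_cast hj
      rw [← Complex.exp_pi_mul_I]
      congr 1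
      push_cast
      field_simp
    · intro i _ hi
      simp [Function.update_of_ne hi]
    · simp
  rw [this]
  norm_num

end Characters

/-! ### Haar measure and uniqueness of Fourier coefficients -/

section Haar

variable (r : ℕ)

instance : MeasurableSpace (Torus r) := borel _
instance : BorelSpace (Torus r) := ⟨rfl⟩

/-- The normalized Haar measure of the torus. -/
def torusMeasure : Measure (Torus r) := Measure.haarMeasure ⊤

instance : (torusMeasure r).IsHaarMeasure := by unfold torusMeasure; infer_instance

instance : IsProbabilityMeasure (torusMeasure r) :=
  ⟨by
    have h := Measure.haarMeasure_self (K₀ := (⊤ : TopologicalSpace.PositiveCompacts (Torus r)))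
    rwa [TopologicalSpace.PositiveCompacts.coe_top] at h⟩

variable {r}

lemma integrable_torus {E : Type*} [NormedAddCommGroup E] {f : Torus r → E}
    (hf : Continuous f) : Integrable f (torusMeasure r) :=
  hf.integrable_of_hasCompactSupport (HasCompactSupport.of_compactSpace f)

/-- Translation by `g` leaves the integral unchanged but multiplies it by `torusChar k g`, which can
be chosen different from `1` when `k ≠ 0`. -/
lemma integral_torusChar (k : Fin r → ℤ) :
    ∫ g, torusChar k g ∂(torusMeasure r) = if k = 0 then 1 else 0 := by
  split_ifs with hk
  · subst hk; simp [torusChar_zero]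
  · obtain ⟨g, hg⟩ := exists_torusChar_ne_one hk
    have h := integral_mul_left_eq_self (μ := torusMeasure r) (torusChar k) g
    simp only [torusChar_mul, integral_const_mul] at h
    by_contra h0
    exact hg (mul_right_cancel₀ h0 (by rw [h, one_mul]))

/-- The characters as continuous functions. -/
def torusCharMap (k : Fin r → ℤ) : C(Torus r, ℂ) := ⟨torusChar k, continuous_torusChar k⟩

/-- Stone–Weierstrass. Characters are closed under products, so the algebra they generate is their
span; conjugation negates `k`, and the coordinate characters separate points. -/
lemma span_torusChar_dense :
    (Submodule.span ℂ (range (torusCharMap (r := r)))).topologicalClosure = ⊤ := by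
  classical
  let A : StarSubalgebra ℂ C(Torus r, ℂ) :=
    { toSubalgebra := Algebra.adjoin ℂ (range torusCharMap)
      star_mem' := by
        change Algebra.adjoin ℂ (range torusCharMap) ≤ star (Algebra.adjoin ℂ (range torusCharMap))
        refine Algebra.adjoin_le ?_
        rintro _ ⟨k, rfl⟩
        refine Algebra.subset_adjoin ⟨-k, ?_⟩
        ext1 x
        exact (conj_torusChar k x).symm }
  have hA : A.toSubalgebra.toSubmodule = Submodule.span ℂ (range torusCharMap) := by
    apply Algebra.adjoin_eq_span_of_subset
    refine .trans (fun x ↦ Submonoid.closure_induction (fun _ ↦ id) ⟨0, ?_⟩ ?_)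
      Submodule.subset_span
    · ext1 z; exact torusChar_zero z
    · rintro _ _ _ _ ⟨m, rfl⟩ ⟨k, rfl⟩
      exact ⟨m + k, by ext1 z; exact torusChar_add m k z⟩
  have hsep : A.SeparatesPoints := by
    intro x y hxy
    obtain ⟨i, hi⟩ := Function.ne_iff.mp hxy
    have hval : ∀ z : Torus r, torusChar (Pi.single i 1) z = z i := by
      intro z
      rw [torusChar, Finset.prod_eq_single i]
      · simp
      · intro j _ hj; simp [Pi.single_eq_of_ne hj]
      · simp
    refine ⟨_, ⟨torusCharMap (Pi.single i 1), Algebra.subset_adjoin ⟨Pi.single i 1, rfl⟩, rfl⟩, ?_⟩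
    change torusChar (Pi.single i 1) x ≠ torusChar (Pi.single i 1) y
    rw [hval, hval, Ne, Circle.coe_inj]
    exact hi
  have h := ContinuousMap.starSubalgebra_topologicalClosure_eq_top_of_separatesPoints A hsep
  rw [← hA]
  exact congr_arg (Subalgebra.toSubmodule <| StarSubalgebra.toSubalgebra ·) h

/-- A continuous function on the torus all of whose Fourier coefficients vanish is zero. -/
lemma eq_zero_of_fourier_eq_zero {h : Torus r → ℂ} (hc : Continuous h)
    (h0 : ∀ k, ∫ g, torusChar k g * h g ∂(torusMeasure r) = 0) : h = 0 := by
  let L : C(Torus r, ℂ) →ₗ[ℂ] ℂ :=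
    { toFun := fun u => ∫ g, u g * h g ∂(torusMeasure r)
      map_add' := fun u v => by
        simp only [ContinuousMap.add_apply, add_mul]
        exact integral_add (integrable_torus (by fun_prop)) (integrable_torus (by fun_prop))
      map_smul' := fun c u => by
        simp only [ContinuousMap.smul_apply, smul_eq_mul, mul_assoc, RingHom.id_apply]
        exact integral_const_mul _ _ }
  have hL : Continuous L := by
    obtain ⟨C, hC⟩ : ∃ C, ∀ g, ‖h g‖ ≤ C := by
      obtain ⟨C, hC⟩ := isCompact_univ.exists_bound_of_continuousOn hc.continuousOn
      exact ⟨C, fun g => hC g (mem_univ g)⟩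
    refine AddMonoidHomClass.continuous_of_bound L C fun u => ?_
    refine (norm_integral_le_of_norm_le_const (C := C * ‖u‖) (ae_of_all _ fun g => ?_)).trans ?_
    · rw [norm_mul, mul_comm]
      exact mul_le_mul (hC g) (u.norm_coe_le_norm g) (norm_nonneg _)
        ((norm_nonneg _).trans (hC g))
    · simp
  have hker : ∀ u, L u = 0 := by
    have hcl : IsClosed (L.ker : Set C(Torus r, ℂ)) := by
      have : (L.ker : Set C(Torus r, ℂ)) = L ⁻¹' {0} := by ext; simp
      rw [this]; exact isClosed_singleton.preimage hL
    have hle : (Submodule.span ℂ (range (torusCharMap (r := r)))).topologicalClosure ≤ L.ker := by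
      refine Submodule.topologicalClosure_minimal _ ?_ hcl
      rw [Submodule.span_le]
      rintro _ ⟨k, rfl⟩
      exact h0 k
    rw [span_torusChar_dense] at hle
    exact fun u => hle (Submodule.mem_top (x := u))
  -- The pairing with `h` kills a dense subspace, hence every continuous function, in particular the
  -- conjugate of `h`.
  have h1 : ∫ g, (‖h g‖ ^ 2 : ℝ) ∂(torusMeasure r) = 0 := by
    have h2 := hker ⟨fun g => (starRingEnd ℂ) (h g), by fun_prop⟩
    have h3 : ∫ g, (((‖h g‖ ^ 2 : ℝ)) : ℂ) ∂(torusMeasure r) = 0 := by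
      rw [← h2]
      refine integral_congr_ae (ae_of_all _ fun g => ?_)
      simp [← Complex.conj_mul']
    rw [integral_complex_ofReal] at h3
    exact_mod_cast h3
  funext x
  by_contra hx
  have h4 := Continuous.integral_pos_of_hasCompactSupport_nonneg_nonzero
    (μ := torusMeasure r) (f := fun g => ‖h g‖ ^ 2) (x := x) (by fun_prop)
    (HasCompactSupport.of_compactSpace _) (fun g => by positivity) (by simpa using hx)
  rw [h1] at h4
  exact lt_irrefl _ h4

end Haar

/-! ### Diagonalization of linear torus actions -/

section WeightBasis

variable {s n : ℕ}

lemma continuous_act (ρ : TorusAction s n) (v : Fin n → ℂ) : Continuous fun g => act ρ g v := by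
  unfold act
  have : Continuous fun g => ((ρ g : GL (Fin n) ℂ) : Matrix (Fin n) (Fin n) ℂ) :=
    Units.continuous_val.comp ρ.continuous_toFun
  exact this.matrix_mulVec continuous_const

lemma act_mul (ρ : TorusAction s n) (g h : Torus s) (v : Fin n → ℂ) :
    act ρ (g * h) v = act ρ g (act ρ h v) := by
  simp [act, Matrix.mulVec_mulVec]

lemma act_one (ρ : TorusAction s n) (v : Fin n → ℂ) : act ρ 1 v = v := by simp [act]

/-- The action of an element of the torus as a linear map. -/
def actLin (ρ : TorusAction s n) (g : Torus s) : (Fin n → ℂ) →ₗ[ℂ] (Fin n → ℂ) :=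
  Matrix.mulVecLin (ρ g : Matrix (Fin n) (Fin n) ℂ)

lemma actLin_apply (ρ : TorusAction s n) (g : Torus s) (v : Fin n → ℂ) :
    actLin ρ g v = act ρ g v := rfl

/-- Every linear torus action can be diagonalized. -/
theorem exists_isWeightBasis (ρ : TorusAction s n) :
    ∃ (b : Module.Basis (Fin n) ℂ (Fin n → ℂ)) (a : Fin n → Fin s → ℤ), IsWeightBasis ρ b a := by
  let S : Set (Fin n → ℂ) := {v | ∃ k : Fin s → ℤ, ∀ g, act ρ g v = torusChar k g • v}
  -- Otherwise a nonzero functional `l` kills all joint eigenvectors. The Fourier coefficients of `g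
  -- ↦ ρ(g) v` are such vectors, so `g ↦ l (ρ(g) v)` vanishes identically, and `g = 1` gives `l v =
  -- 0`.
  have hS : ⊤ ≤ Submodule.span ℂ S := by
    by_contra hlt
    obtain ⟨l, hl0, hl⟩ := Submodule.exists_le_ker_of_lt_top _
      (lt_top_iff_ne_top.mpr fun h => hlt h.ge)
    apply hl0
    refine LinearMap.ext fun v => ?_
    let L : (Fin n → ℂ) →L[ℂ] ℂ := LinearMap.toContinuousLinearMap l
    have hcont : Continuous fun g => act ρ g v := continuous_act ρ v
    have hz : (fun g => l (act ρ g v)) = 0 := by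
      refine eq_zero_of_fourier_eq_zero (L.continuous.comp hcont) fun k => ?_
      have hint : Integrable (fun g => torusChar k g • act ρ g v) (torusMeasure s) :=
        integrable_torus ((continuous_torusChar k).smul hcont)
      have hw : (∫ g, torusChar k g • act ρ g v ∂(torusMeasure s)) ∈ S := by
        refine ⟨-k, fun g => ?_⟩
        have h1 := (LinearMap.toContinuousLinearMap (actLin ρ g)).integral_comp_comm hint
        have h2 := integral_mul_left_eq_self (μ := torusMeasure s)
          (fun h => torusChar k h • act ρ h v) g
        conv_rhs => rw [← h2, ← integral_smul]
        refine h1.symm.trans (integral_congr_ae (ae_of_all _ fun h => ?_))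
        simp only [LinearMap.coe_toContinuousLinearMap', map_smul, actLin_apply, act_mul,
          torusChar_mul, smul_smul]
        rw [← mul_assoc, torusChar_neg, inv_mul_cancel₀ (torusChar_ne_zero k g), one_mul]
      have h3 := L.integral_comp_comm hint
      have h4 : L (∫ g, torusChar k g • act ρ g v ∂(torusMeasure s)) = 0 :=
        hl (Submodule.subset_span hw)
      rw [h4] at h3
      rw [← h3]
      refine integral_congr_ae (ae_of_all _ fun h => ?_)
      simp [L]
    have := congr_fun hz 1
    simpa [act_one] using this
  obtain ⟨ι, B, hB⟩ : ∃ (ι : Type) (B : Module.Basis ι ℂ (Fin n → ℂ)), ∀ i, B i ∈ S :=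
    ⟨_, Module.Basis.ofSpan hS, fun i => Module.Basis.ofSpan_subset hS (mem_range_self i)⟩
  have : Fintype ι := FiniteDimensional.fintypeBasisIndex B
  have hcard : Fintype.card ι = Fintype.card (Fin n) := by
    rw [← Module.finrank_eq_card_basis B]; simp
  let b := B.reindex (Fintype.equivOfCardEq hcard)
  have hb : ∀ i, b i ∈ S := fun i => by
    simp only [b, Module.Basis.reindex_apply]
    exact hB _
  choose a ha using hb
  exact ⟨b, a, fun g i => ha i g⟩

end WeightBasis

/-! ### Holomorphic functions of several variables: parameter integrals and smoothness -/

section SeveralVariables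

variable {n : ℕ} {E : Type} [NormedAddCommGroup E] [NormedSpace ℂ E]

/-- **Cauchy estimate** for the derivative. -/
lemma norm_fderiv_le_of_bound {f : (Fin n → ℂ) → E} {x : Fin n → ℂ} {R C : ℝ} (hR : 0 < R)
    (hd : DifferentiableOn ℂ f (ball x R)) (hb : ∀ y ∈ ball x R, ‖f y‖ ≤ C) :
    ‖fderiv ℂ f x‖ ≤ (C + C) / R := by
  refine Complex.norm_fderiv_le_div_of_mapsTo_ball hd (fun y hy => ?_) hR
  rw [mem_closedBall, dist_eq_norm]
  exact (norm_sub_le _ _).trans (add_le_add (hb y hy) (hb x (mem_ball_self hR)))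

/-- Reduces measurability and holomorphy of a full derivative to those of finitely many directional
derivatives. -/
lemma clm_eq_sum (A : (Fin n → ℂ) →L[ℂ] E) :
    A = ∑ i, (ContinuousLinearMap.proj i : (Fin n → ℂ) →L[ℂ] ℂ).smulRight (A (Pi.single i 1)) := by
  ext1 v
  conv_lhs => rw [pi_eq_sum_univ' v]
  simp [map_sum]

/-- An integral over a compact parameter set of functions depending holomorphically on `x` is
holomorphic in `x`. -/
theorem differentiableOn_integral {T : Type*} [TopologicalSpace T] [MeasurableSpace T]
    [BorelSpace T] [SecondCountableTopology T] [T2Space T] {ν : Measure T}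
    [IsFiniteMeasureOnCompacts ν] {K : Set T} (hK : IsCompact K)
    {U : Set (Fin n → ℂ)} (hU : IsOpen U) {F : (Fin n → ℂ) → T → E}
    (hc : ContinuousOn (Function.uncurry F) (U ×ˢ K))
    (hd : ∀ t ∈ K, DifferentiableOn ℂ (fun x => F x t) U) :
    DifferentiableOn ℂ (fun x => ∫ t in K, F x t ∂ν) U := by
  intro x₀ hx₀
  obtain ⟨R', hR', hball'⟩ := Metric.nhds_basis_closedBall.mem_iff.mp (hU.mem_nhds hx₀)
  -- Halving the radius keeps balls of radius `R` about points of `ball x₀ R` inside the region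
  -- where `F` is bounded by `C`, so the Cauchy estimate dominates all these derivatives by one
  -- constant.
  obtain ⟨R, hR, hRR⟩ : ∃ R, 0 < R ∧ R + R = R' := ⟨R' / 2, by positivity, by ring⟩
  have hsub : closedBall x₀ R' ×ˢ K ⊆ U ×ˢ K := prod_mono hball' subset_rfl
  obtain ⟨C, hC⟩ := ((isCompact_closedBall x₀ R').prod hK).exists_bound_of_continuousOn
    (hc.mono hsub)
  have hCx : ∀ x ∈ closedBall x₀ R', ∀ t ∈ K, ‖F x t‖ ≤ C := fun x hx t ht => hC (x, t) ⟨hx, ht⟩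
  have hcx : ∀ x ∈ U, ContinuousOn (F x) K := fun x hx =>
    hc.comp (f := fun t => (x, t)) (by fun_prop) fun t ht => ⟨hx, ht⟩
  have hballsub : ∀ x ∈ ball x₀ R, ball x R ⊆ closedBall x₀ R' := fun x hx y hy => by
    rw [mem_ball] at hx hy
    rw [mem_closedBall, ← hRR]
    exact (dist_triangle y x x₀).trans (by linarith)
  have hxU : ∀ x ∈ ball x₀ R, x ∈ U := fun x hx =>
    hball' (hballsub x hx (mem_ball_self hR))
  -- Measurability in the parameter: each directional derivative is a limit of difference quotients
  -- along the steps `ε / (m + 1)`.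
  have hmeas : AEStronglyMeasurable (fun t => fderiv ℂ (fun x => F x t) x₀) (ν.restrict K) := by
    have hv : ∀ v, AEStronglyMeasurable (fun t => fderiv ℂ (fun x => F x t) x₀ v)
        (ν.restrict K) := by
      intro v
      obtain ⟨ε, hε, hεv⟩ : ∃ ε : ℝ, 0 < ε ∧ ∀ m : ℕ, x₀ + (ε / (m + 1) : ℝ) • v ∈ U := by
        refine ⟨R / (‖v‖ + 1), by positivity, fun m => hxU _ ?_⟩
        rw [mem_ball, dist_eq_norm, add_sub_cancel_left, norm_smul, Real.norm_of_nonneg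
          (by positivity), div_div, div_mul_eq_mul_div, div_lt_iff₀ (by positivity)]
        refine mul_lt_mul_of_pos_left ?_ hR
        nlinarith [norm_nonneg v, (Nat.cast_nonneg m : (0 : ℝ) ≤ m)]
      have hlim : Tendsto (fun m : ℕ => ε / ((m : ℝ) + 1)) atTop (𝓝[≠] 0) := by
        refine tendsto_nhdsWithin_iff.mpr ⟨?_, Eventually.of_forall fun m => ?_⟩
        · exact (tendsto_const_nhds (x := ε)).div_atTop
            (tendsto_atTop_add_const_right _ _ tendsto_natCast_atTop_atTop)
        · have : ε / ((m : ℝ) + 1) ≠ 0 := by positivity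
          exact this
      refine aestronglyMeasurable_of_tendsto_ae atTop
        (f := fun (m : ℕ) t => (ε / ((m : ℝ) + 1) : ℝ)⁻¹ •
          (F (x₀ + (ε / ((m : ℝ) + 1) : ℝ) • v) t - F x₀ t)) (fun m => ?_) ?_
      · refine AEStronglyMeasurable.const_smul (AEStronglyMeasurable.sub ?_ ?_) _
        · exact (hcx _ (hεv m)).aestronglyMeasurable_of_isCompact hK hK.measurableSet
        · exact (hcx _ hx₀).aestronglyMeasurable_of_isCompact hK hK.measurableSet
      · refine (ae_restrict_iff' hK.measurableSet).mpr (ae_of_all _ fun t ht => ?_)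
        have h1 : HasFDerivAt (fun x => F x t) (fderiv ℂ (fun x => F x t) x₀) x₀ :=
          ((hd t ht).differentiableAt (hU.mem_nhds hx₀)).hasFDerivAt
        have h2 := ((h1.restrictScalars ℝ).hasLineDerivAt v).tendsto_slope_zero
        exact h2.comp hlim
    have : (fun t => fderiv ℂ (fun x => F x t) x₀) = fun t =>
        ∑ i, (ContinuousLinearMap.smulRightL ℂ (Fin n → ℂ) E
          (ContinuousLinearMap.proj i : (Fin n → ℂ) →L[ℂ] ℂ))
          (fderiv ℂ (fun x => F x t) x₀ (Pi.single i 1)) := by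
      funext t
      exact clm_eq_sum _
    rw [this]
    exact Finset.aestronglyMeasurable_fun_sum _ fun i _ =>
      (ContinuousLinearMap.continuous _).comp_aestronglyMeasurable (hv _)
  refine (hasFDerivAt_integral_of_dominated_of_fderiv_le (s := ball x₀ R)
    (F' := fun x t => fderiv ℂ (fun x => F x t) x) (bound := fun _ => (C + C) / R)
    (ball_mem_nhds _ hR) ?_ ?_ hmeas ?_ ?_ ?_).differentiableAt.differentiableWithinAt
  · filter_upwards [hU.mem_nhds hx₀] with x hx
    exact (hcx x hx).aestronglyMeasurable_of_isCompact hK hK.measurableSet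
  · exact (hcx x₀ hx₀).integrableOn_compact hK
  · refine (ae_restrict_iff' hK.measurableSet).mpr (ae_of_all _ fun t ht x hx => ?_)
    refine norm_fderiv_le_of_bound hR ((hd t ht).mono ((hballsub x hx).trans hball')) ?_
    exact fun y hy => hCx y (hballsub x hx hy) t ht
  · exact integrableOn_const hK.measure_lt_top.ne
  · refine (ae_restrict_iff' hK.measurableSet).mpr (ae_of_all _ fun t ht x hx => ?_)
    exact ((hd t ht).differentiableAt (hU.mem_nhds (hxU x hx))).hasFDerivAt

/-- The directional derivatives of a holomorphic function are holomorphic. -/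
theorem differentiableOn_fderiv_apply [CompleteSpace E] {U : Set (Fin n → ℂ)} (hU : IsOpen U)
    {f : (Fin n → ℂ) → E} (hf : DifferentiableOn ℂ f U) (v : Fin n → ℂ) :
    DifferentiableOn ℂ (fun x => fderiv ℂ f x v) U := by
  intro x₀ hx₀
  obtain ⟨R', hR', hball'⟩ := Metric.nhds_basis_ball.mem_iff.mp (hU.mem_nhds hx₀)
  obtain ⟨R, hR, hRR⟩ : ∃ R, 0 < R ∧ R + R = R' := ⟨R' / 2, by positivity, by ring⟩
  obtain ⟨ε, hε, hεv⟩ : ∃ ε : ℝ, 0 < ε ∧ ε * ‖v‖ < R := by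
    refine ⟨R / (‖v‖ + 1), by positivity, ?_⟩
    rw [div_mul_eq_mul_div, div_lt_iff₀ (by positivity)]
    exact mul_lt_mul_of_pos_left (lt_add_one _) hR
  have hmem : ∀ x ∈ ball x₀ R, ∀ z : ℂ, ‖z‖ ≤ ε → x + z • v ∈ U := fun x hx z hz => by
    apply hball'
    rw [mem_ball, dist_eq_norm] at hx ⊢
    calc ‖x + z • v - x₀‖ = ‖(x - x₀) + z • v‖ := by congr 1; abel
      _ ≤ ‖x - x₀‖ + ‖z‖ * ‖v‖ := (norm_add_le _ _).trans_eq (by rw [norm_smul])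
      _ ≤ ‖x - x₀‖ + ε * ‖v‖ := by gcongr
      _ < R' := by linarith
  have hcirc : ∀ θ : ℝ, ‖circleMap 0 ε θ‖ ≤ ε := fun θ => by
    rw [norm_circleMap_zero, abs_of_pos hε]
  -- The one-variable Cauchy formula on the slice `z ↦ f (x + z • v)` writes the directional
  -- derivative as a parameter integral, holomorphic in `x`.
  have hcauchy : ∀ x ∈ ball x₀ R, (2 * Real.pi * Complex.I : ℂ) • fderiv ℂ f x v =
      ∫ θ in Icc 0 (2 * Real.pi), deriv (circleMap 0 ε) θ •
        ((1 / (circleMap 0 ε θ) ^ 2) • f (x + circleMap 0 ε θ • v)) := by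
    intro x hx
    have hd : DifferentiableOn ℂ (fun z : ℂ => f (x + z • v)) (closedBall 0 ε) := by
      refine hf.comp (by fun_prop) fun z hz => hmem x hx z ?_
      simpa using hz
    have h1 := hd.deriv_eq_smul_circleIntegral hε
    have h2 : deriv (fun z : ℂ => f (x + z • v)) 0 = fderiv ℂ f x v := by
      have hxU : x ∈ U := by simpa using hmem x hx 0 (by simpa using hε.le)
      have h3 : HasFDerivAt f (fderiv ℂ f x) x :=
        (hf.differentiableAt (hU.mem_nhds hxU)).hasFDerivAt
      exact (h3.hasLineDerivAt v).deriv
    rw [h2] at h1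
    rw [← h1, circleIntegral, intervalIntegral.integral_of_le (by positivity),
      integral_Icc_eq_integral_Ioc]
    simp
  have hdiff : DifferentiableOn ℂ (fun x => ∫ θ in Icc 0 (2 * Real.pi), deriv (circleMap 0 ε) θ •
        ((1 / (circleMap 0 ε θ) ^ 2) • f (x + circleMap 0 ε θ • v))) (ball x₀ R) := by
    refine differentiableOn_integral isCompact_Icc isOpen_ball ?_ fun θ _ => ?_
    · have h1 : Continuous fun p : (Fin n → ℂ) × ℝ => deriv (circleMap 0 ε) p.2 := by
        simp only [deriv_circleMap]; fun_prop
      have h2 : Continuous fun p : (Fin n → ℂ) × ℝ => 1 / (circleMap 0 ε p.2) ^ 2 := by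
        refine continuous_const.div (by fun_prop) fun p => ?_
        exact pow_ne_zero _ (circleMap_ne_center hε.ne')
      refine h1.continuousOn.smul (h2.continuousOn.smul ?_)
      refine hf.continuousOn.comp (by fun_prop) fun p hp => hmem _ hp.1 _ (hcirc _)
    · refine DifferentiableOn.const_smul (DifferentiableOn.const_smul ?_ _) _
      exact hf.comp (by fun_prop) fun x hx => hmem x hx _ (hcirc _)
  have h2pi : (2 * Real.pi * Complex.I : ℂ) ≠ 0 := Complex.two_pi_I_ne_zero
  have h4 := ((hdiff x₀ (mem_ball_self hR)).differentiableAt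
    (isOpen_ball.mem_nhds (mem_ball_self hR))).const_smul (2 * Real.pi * Complex.I : ℂ)⁻¹
  refine (h4.congr_of_eventuallyEq ?_).differentiableWithinAt
  filter_upwards [ball_mem_nhds x₀ hR] with x hx
  rw [Pi.smul_apply, ← hcauchy x hx, inv_smul_smul₀ h2pi]

theorem differentiableOn_fderiv [CompleteSpace E] {U : Set (Fin n → ℂ)} (hU : IsOpen U)
    {f : (Fin n → ℂ) → E} (hf : DifferentiableOn ℂ f U) :
    DifferentiableOn ℂ (fderiv ℂ f) U := by
  have : fderiv ℂ f = fun x => ∑ i, (ContinuousLinearMap.smulRightL ℂ (Fin n → ℂ) E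
      (ContinuousLinearMap.proj i : (Fin n → ℂ) →L[ℂ] ℂ)) (fderiv ℂ f x (Pi.single i 1)) :=
    funext fun x => clm_eq_sum _
  rw [this]
  exact DifferentiableOn.fun_sum fun i _ =>
    (ContinuousLinearMap.differentiable _).comp_differentiableOn
    (differentiableOn_fderiv_apply hU hf _)

/-- The target space is quantified inside the induction because the derivative takes values in a new
space of linear maps. -/
theorem contDiffOn_of_holomorphic {U : Set (Fin n → ℂ)} (hU : IsOpen U) (m : ℕ) :
    ∀ (E : Type) [NormedAddCommGroup E] [NormedSpace ℂ E] [CompleteSpace E]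
      {f : (Fin n → ℂ) → E}, DifferentiableOn ℂ f U → ContDiffOn ℂ m f U := by
  induction m with
  | zero =>
    intro E _ _ _ f hf
    simpa using hf.continuousOn
  | succ m ih =>
    intro E _ _ _ f hf
    push_cast
    rw [contDiffOn_succ_iff_fderiv_of_isOpen hU]
    exact ⟨hf, by simp, ih _ (differentiableOn_fderiv hU hf)⟩

end SeveralVariables

/-! ### Homogeneous expansions and the identity theorem -/

section Taylor

variable {n : ℕ}

/-- A multilinear form evaluated on the diagonal is a homogeneous polynomial. -/
lemma exists_isHomogeneous_eval_eq {j : ℕ} (p : (Fin n → ℂ) [×j]→L[ℂ] ℂ) :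
    ∃ P : MvPolynomial (Fin n) ℂ, P.IsHomogeneous j ∧ ∀ x, eval x P = p fun _ => x := by
  classical
  refine ⟨∑ s : Fin j → Fin n, C (p fun l => Pi.single (s l) 1) * ∏ l, X (s l), ?_, fun x => ?_⟩
  · refine IsHomogeneous.sum _ _ _ fun s _ => ?_
    have h := IsHomogeneous.prod (R := ℂ) Finset.univ (fun l => X (s l)) (fun _ => 1)
      fun l _ => isHomogeneous_X ℂ (s l)
    simpa using h.C_mul _
  · conv_rhs => rw [pi_eq_sum_univ' x]
    rw [ContinuousMultilinearMap.map_sum, map_sum]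
    refine Finset.sum_congr rfl fun s _ => ?_
    rw [ContinuousMultilinearMap.map_smul_univ]
    simp [mul_comm]

/-- Leaves room beyond `t = 1` on the complex line through `x`, so that one-variable theorems on
discs apply at `t = 1`. -/
lemma exists_one_lt_ball {x : Fin n → ℂ} {R : ℝ} (hx : x ∈ ball 0 R) :
    ∃ ρ : ℝ, 1 < ρ ∧ ∀ t ∈ ball (0 : ℂ) ρ, t • x ∈ ball 0 R := by
  rw [mem_ball_zero_iff] at hx
  have hR : 0 < R := (norm_nonneg x).trans_lt hx
  refine ⟨2 * R / (‖x‖ + R), ?_, fun t ht => ?_⟩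
  · rw [one_lt_div (by positivity)]; linarith
  · rw [mem_ball_zero_iff] at ht ⊢
    rw [lt_div_iff₀ (by positivity)] at ht
    rw [norm_smul]
    nlinarith [norm_nonneg t, norm_nonneg x]

/-- Expansion of a holomorphic function into homogeneous polynomials on a ball around `0`, with
Cauchy estimates. -/
theorem exists_homogeneous_expansion {g : (Fin n → ℂ) → ℂ} {R : ℝ}
    (hg : DifferentiableOn ℂ g (ball 0 R)) :
    ∃ G : ℕ → MvPolynomial (Fin n) ℂ, (∀ j, (G j).IsHomogeneous j) ∧
      (∀ x ∈ ball 0 R, HasSum (fun j => eval x (G j)) (g x)) ∧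
      ∀ j, ∀ x ∈ ball 0 R, ∀ M, (∀ t : ℂ, ‖t‖ = 1 → ‖g (t • x)‖ ≤ M) → ‖eval x (G j)‖ ≤ M := by
  choose P hP hPe using fun j => exists_isHomogeneous_eval_eq (iteratedFDeriv ℂ j g 0)
  -- Up to `j!`, the homogeneous term of degree `j` at `x` is the Taylor coefficient of the slice `t
  -- ↦ g (t • x)`.
  have hslice : ∀ x ∈ ball 0 R, ∀ j,
      iteratedDeriv j (fun t : ℂ => g (t • x)) 0 = eval x (P j) := by
    intro x hx j
    have h0 : (0 : Fin n → ℂ) ∈ ball 0 R := mem_ball_self (pos_of_mem_ball hx)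
    let L : ℂ →L[ℂ] (Fin n → ℂ) := ContinuousLinearMap.toSpanSingleton ℂ x
    have hL0 : L 0 = 0 := map_zero L
    have hopen : IsOpen (L ⁻¹' ball 0 R) := isOpen_ball.preimage L.continuous
    have hmem : (0 : ℂ) ∈ L ⁻¹' ball 0 R := by rw [mem_preimage, hL0]; exact h0
    have h1 := L.iteratedFDerivWithin_comp_right (n := j) (i := j)
      (contDiffOn_of_holomorphic isOpen_ball j ℂ hg)
      isOpen_ball.uniqueDiffOn hopen.uniqueDiffOn (x := 0) (by rwa [hL0]) le_rfl
    rw [iteratedFDerivWithin_of_isOpen j hopen hmem, hL0,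
      iteratedFDerivWithin_of_isOpen j isOpen_ball h0] at h1
    rw [iteratedDeriv_eq_iteratedFDeriv, hPe]
    have h2 := congrArg (fun q => q fun _ => (1 : ℂ)) h1
    simpa [L, Function.comp_def] using h2
  have hd : ∀ x, ∀ ρ, (∀ t ∈ ball (0 : ℂ) ρ, t • x ∈ ball (0 : Fin n → ℂ) R) →
      DifferentiableOn ℂ (fun t : ℂ => g (t • x)) (ball 0 ρ) := fun x ρ h =>
    hg.comp (by fun_prop) h
  have hev : ∀ x j, eval x (C ((j.factorial : ℂ)⁻¹) * P j) = (j.factorial : ℂ)⁻¹ * eval x (P j) :=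
    fun x j => by simp
  refine ⟨fun j => C ((j.factorial : ℂ)⁻¹) * P j, fun j => (hP j).C_mul _, fun x hx => ?_,
    fun j x hx M hM => ?_⟩
  · obtain ⟨ρ, hρ, hρx⟩ := exists_one_lt_ball hx
    have h := Complex.hasSum_taylorSeries_on_ball (hd x ρ hρx) (z := 1)
      (by rw [mem_ball_zero_iff]; simpa using hρ)
    simp only [hev]
    simpa [hslice x hx] using h
  · obtain ⟨ρ, hρ, hρx⟩ := exists_one_lt_ball hx
    have hcl : closedBall (0 : ℂ) 1 ⊆ ball 0 ρ := closedBall_subset_ball hρ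
    have h := Complex.norm_iteratedDeriv_le_of_forall_mem_sphere_norm_le (c := (0 : ℂ)) (R := 1)
      (C := M) (f := fun t : ℂ => g (t • x)) j one_pos
      (((hd x ρ hρx).mono hcl).diffContOnCl_ball subset_rfl)
      (fun z hz => hM z (by simpa using hz))
    rw [hslice x hx, one_pow, div_one] at h
    rw [hev, norm_mul, norm_inv, Complex.norm_natCast, inv_mul_le_iff₀ (by positivity)]
    exact h

/-- The identity theorem for holomorphic functions of several variables. -/
theorem eqOn_zero_of_eventuallyEq {g : (Fin n → ℂ) → ℂ} {U : Set (Fin n → ℂ)} (hU : IsOpen U)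
    (hUc : IsPreconnected U) (hg : DifferentiableOn ℂ g U) {x₀ : Fin n → ℂ} (hx₀ : x₀ ∈ U)
    (h0 : g =ᶠ[𝓝 x₀] 0) : EqOn g 0 U := by
  let S : Set (Fin n → ℂ) := {x | g =ᶠ[𝓝 x] 0}
  have hS : IsOpen S := isOpen_setOfPred_eventually_nhds
  -- One-variable identity theorem on each complex line through `y`; this makes `S` relatively
  -- closed in `U`.
  have hball : ∀ y ε, y ∈ S → ball y ε ⊆ U → ∀ z ∈ ball y ε, g z = 0 := by
    intro y ε hy hsub z hz
    have hz' : z - y ∈ ball (0 : Fin n → ℂ) ε := by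
      rwa [mem_ball_zero_iff, ← dist_eq_norm]
    obtain ⟨ρ, hρ, hρx⟩ := exists_one_lt_ball hz'
    have hd : DifferentiableOn ℂ (fun t : ℂ => g (y + t • (z - y))) (ball 0 ρ) := by
      refine hg.comp (by fun_prop) fun t ht => hsub ?_
      have := hρx t ht
      rw [mem_ball_zero_iff] at this
      rwa [mem_ball, dist_eq_norm, add_sub_cancel_left]
    have hcont : ContinuousAt (fun t : ℂ => y + t • (z - y)) 0 := by fun_prop
    have hev : (fun t : ℂ => g (y + t • (z - y))) =ᶠ[𝓝 0] 0 := by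
      have : Tendsto (fun t : ℂ => y + t • (z - y)) (𝓝 0) (𝓝 y) := by
        simpa [ContinuousAt] using hcont
      exact this.eventually hy
    have := (hd.analyticOnNhd isOpen_ball).eqOn_zero_of_preconnected_of_eventuallyEq_zero
      (convex_ball _ _).isPreconnected (mem_ball_self (by linarith)) hev
      (show (1 : ℂ) ∈ ball 0 ρ by rw [mem_ball_zero_iff]; simpa using hρ)
    simpa using this
  have hsub : U ⊆ S := by
    refine hUc.subset_of_closure_inter_subset hS ⟨x₀, hx₀, h0⟩ fun x hx => ?_
    obtain ⟨ε, hε, hεU⟩ := Metric.nhds_basis_ball.mem_iff.mp (hU.mem_nhds hx.2)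
    obtain ⟨y, hyS, hxy⟩ := Metric.mem_closure_iff.mp hx.1 (ε / 2) (by positivity)
    have hyU : ball y (ε / 2) ⊆ U := fun z hz => hεU (by
      rw [mem_ball] at hz ⊢
      rw [dist_comm] at hxy
      linarith [dist_triangle z y x])
    filter_upwards [isOpen_ball.mem_nhds (mem_ball.mpr hxy)] with z hz
    exact hball y _ hyS hyU z hz
  exact fun x hx => (hsub hx).self_of_nhds

end Taylor

/-! ### Weight decomposition under a diagonal action -/

section DiagonalAction

variable {r n : ℕ}

/-- The diagonal action of the torus with weights `a`. -/
def diagAct (a : Fin n → Fin r → ℤ) (g : Torus r) (x : Fin n → ℂ) : Fin n → ℂ :=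
  fun i => torusChar (a i) g * x i

/-- The weight of a monomial. -/
def wt (a : Fin n → Fin r → ℤ) (α : Fin n →₀ ℕ) : Fin r → ℤ := ∑ i, α i • a i

/-- The monomial function `x ↦ x^α`. -/
def mono (α : Fin n →₀ ℕ) (x : Fin n → ℂ) : ℂ := ∏ i, x i ^ α i

lemma eval_eq_sum_mono (P : MvPolynomial (Fin n) ℂ) (x : Fin n → ℂ) :
    eval x P = ∑ α ∈ P.support, P.coeff α * mono α x := eval_eq' x P

lemma eval_monomial_eq_mono (α : Fin n →₀ ℕ) (c : ℂ) (x : Fin n → ℂ) :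
    eval x (monomial α c) = c * mono α x := by
  rw [eval_monomial, Finsupp.prod_fintype _ _ (by simp)]; rfl

lemma differentiable_mono (α : Fin n →₀ ℕ) : Differentiable ℂ (mono α) := by
  unfold mono; fun_prop

lemma continuous_mono (α : Fin n →₀ ℕ) : Continuous (mono α) := (differentiable_mono α).continuous

lemma wt_zero (a : Fin n → Fin r → ℤ) : wt a 0 = 0 := by simp [wt]

lemma wt_add (a : Fin n → Fin r → ℤ) (α β : Fin n →₀ ℕ) : wt a (α + β) = wt a α + wt a β := by
  simp [wt, add_smul, Finset.sum_add_distrib]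

lemma wt_single (a : Fin n → Fin r → ℤ) (i : Fin n) : wt a (Finsupp.single i 1) = a i := by
  rw [wt, Finset.sum_eq_single i]
  · simp
  · intro j _ hj; simp [Finsupp.single_eq_of_ne hj]
  · simp

lemma mono_zero (x : Fin n → ℂ) : mono 0 x = 1 := by simp [mono]

lemma mono_single (i : Fin n) (x : Fin n → ℂ) : mono (Finsupp.single i 1) x = x i := by
  rw [mono, Finset.prod_eq_single i]
  · simp
  · intro j _ hj; simp [Finsupp.single_eq_of_ne hj]
  · simp

lemma mono_diagAct (a : Fin n → Fin r → ℤ) (g : Torus r) (α : Fin n →₀ ℕ) (x : Fin n → ℂ) :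
    mono α (diagAct a g x) = torusChar (wt a α) g * mono α x := by
  simp only [mono, diagAct, wt, mul_pow, Finset.prod_mul_distrib, torusChar_sum, torusChar_nsmul]

lemma mono_smul (α : Fin n →₀ ℕ) (t : ℂ) (x : Fin n → ℂ) :
    mono α (t • x) = t ^ α.degree * mono α x := by
  simp [mono, mul_pow, Finset.prod_mul_distrib, Finset.prod_pow_eq_pow_sum, Finsupp.degree_eq_sum]

lemma eval_smul_of_isHomogeneous {P : MvPolynomial (Fin n) ℂ} {j : ℕ} (hP : P.IsHomogeneous j)
    (t : ℂ) (x : Fin n → ℂ) : eval (t • x) P = t ^ j * eval x P := by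
  rw [eval_eq_sum_mono, eval_eq_sum_mono, Finset.mul_sum]
  refine Finset.sum_congr rfl fun α hα => ?_
  have hd : α.degree = j := by
    by_contra h
    exact mem_support_iff.mp hα (hP.coeff_eq_zero h)
  rw [mono_smul, hd]
  ring

lemma norm_mono_le (α : Fin n →₀ ℕ) (x : Fin n → ℂ) : ‖mono α x‖ ≤ ‖x‖ ^ α.degree := by
  rw [mono, norm_prod, Finsupp.degree_eq_sum, ← Finset.prod_pow_eq_pow_sum]
  refine Finset.prod_le_prod (fun i _ => norm_nonneg _) fun i _ => ?_
  rw [norm_pow]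
  exact pow_le_pow_left₀ (norm_nonneg _) (norm_le_pi_norm x i) _

lemma norm_diagAct (a : Fin n → Fin r → ℤ) (g : Torus r) (x : Fin n → ℂ) :
    ‖diagAct a g x‖ = ‖x‖ := by
  simp [Pi.norm_def, diagAct, nnnorm_mul,
    show ∀ i, ‖torusChar (a i) g‖₊ = 1 from fun i => NNReal.eq (norm_torusChar _ _)]

lemma diagAct_mul (a : Fin n → Fin r → ℤ) (g h : Torus r) (x : Fin n → ℂ) :
    diagAct a (g * h) x = diagAct a g (diagAct a h x) := by
  funext i; simp [diagAct, torusChar_mul, mul_assoc]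

lemma diagAct_one (a : Fin n → Fin r → ℤ) (x : Fin n → ℂ) : diagAct a 1 x = x := by
  funext i; simp [diagAct, torusChar_one]

lemma continuous_diagAct (a : Fin n → Fin r → ℤ) :
    Continuous fun p : Torus r × (Fin n → ℂ) => diagAct a p.1 p.2 := by
  refine continuous_pi fun i => ?_
  exact ((continuous_torusChar (a i)).comp continuous_fst).mul
    ((continuous_apply i).comp continuous_snd)

lemma differentiable_diagAct (a : Fin n → Fin r → ℤ) (g : Torus r) :
    Differentiable ℂ (diagAct a g) := by
  unfold diagAct; fun_prop

lemma integral_torusChar_mul (k l : Fin r → ℤ) :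
    ∫ g, torusChar (-k) g * torusChar l g ∂(torusMeasure r) = if l = k then 1 else 0 := by
  simp_rw [← torusChar_add, integral_torusChar]
  congr 1
  rw [neg_add_eq_zero, eq_comm (a := k)]

/-- The torus average of a polynomial against a character is its weight component. -/
lemma integral_eval_diagAct (a : Fin n → Fin r → ℤ) (k : Fin r → ℤ) (P : MvPolynomial (Fin n) ℂ)
    (x : Fin n → ℂ) :
    ∫ g, torusChar (-k) g * eval (diagAct a g x) P ∂(torusMeasure r) =
      ∑ α ∈ P.support with wt a α = k, P.coeff α * mono α x := by
  simp_rw [eval_eq_sum_mono, mono_diagAct, Finset.mul_sum]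
  rw [integral_finsetSum _ fun α _ => integrable_torus (by fun_prop), Finset.sum_filter]
  refine Finset.sum_congr rfl fun α _ => ?_
  have : ∀ g : Torus r, torusChar (-k) g * (P.coeff α * (torusChar (wt a α) g * mono α x)) =
      (P.coeff α * mono α x) * (torusChar (-k) g * torusChar (wt a α) g) := fun g => by ring
  simp_rw [this, integral_const_mul, integral_torusChar_mul]
  split_ifs <;> simp

lemma measurePreserving_diagAct (a : Fin n → Fin r → ℤ) (g : Torus r) :
    MeasurePreserving (diagAct a g) volume volume := by
  refine volume_preserving_pi fun i => ?_
  let u : Circle := ⟨torusChar (a i) g, mem_sphere_zero_iff_norm.mpr (norm_torusChar _ _)⟩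
  exact (rotation u).measurePreserving

lemma measurableEmbedding_diagAct (a : Fin n → Fin r → ℤ) (g : Torus r) :
    MeasurableEmbedding (diagAct a g) := by
  let e : (Fin n → ℂ) ≃ₜ (Fin n → ℂ) :=
    { toFun := diagAct a g
      invFun := diagAct a g⁻¹
      left_inv := fun x => by rw [← diagAct_mul, inv_mul_cancel, diagAct_one]
      right_inv := fun x => by rw [← diagAct_mul, mul_inv_cancel, diagAct_one]
      continuous_toFun := (differentiable_diagAct a g).continuous
      continuous_invFun := (differentiable_diagAct a g⁻¹).continuous }
  exact e.measurableEmbedding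

lemma preimage_diagAct {a : Fin n → Fin r → ℤ} {U : Set (Fin n → ℂ)}
    (hinv : ∀ g, ∀ x ∈ U, diagAct a g x ∈ U) (g : Torus r) : diagAct a g ⁻¹' U = U := by
  refine Subset.antisymm (fun x hx => ?_) (hinv g)
  have := hinv g⁻¹ _ hx
  rwa [← diagAct_mul, inv_mul_cancel, diagAct_one] at this

/-- Taylor coefficients at the origin of a holomorphic function on an invariant domain; its weight
components are polynomials. -/
theorem exists_weight_expansion {a : Fin n → Fin r → ℤ} (hA : ∀ k, {α | wt a α = k}.Finite)
    {U : Set (Fin n → ℂ)} (hU : IsOpen U) (hUc : IsPreconnected U) (hU0 : 0 ∈ U)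
    (hinv : ∀ g, ∀ x ∈ U, diagAct a g x ∈ U) {f : (Fin n → ℂ) → ℂ}
    (hf : DifferentiableOn ℂ f U) :
    ∃ c : (Fin n →₀ ℕ) → ℂ,
      (∀ k, ∀ x ∈ U, ∫ g, torusChar (-k) g * f (diagAct a g x) ∂(torusMeasure r) =
        ∑ α ∈ (hA k).toFinset, c α * mono α x) ∧
      (∀ m : ℕ, (f =O[𝓝 0] fun x => ‖x‖ ^ m) → ∀ α, α.degree < m → c α = 0) ∧
      ∀ S : Finset (Fin n →₀ ℕ), (∀ α ∉ S, c α = 0) →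
        ∀ x ∈ U, f x = ∑ α ∈ S, c α * mono α x := by
  obtain ⟨R, hR, hRU⟩ := Metric.nhds_basis_closedBall.mem_iff.mp (hU.mem_nhds hU0)
  have hRU' : ball (0 : Fin n → ℂ) R ⊆ U := ball_subset_closedBall.trans hRU
  obtain ⟨M, hM⟩ := (isCompact_closedBall (0 : Fin n → ℂ) R).exists_bound_of_continuousOn
    (hf.continuousOn.mono hRU)
  obtain ⟨G, hGh, hGs, hGb⟩ := exists_homogeneous_expansion (hf.mono hRU')
  -- The exponent `α` occurs only in the homogeneous part of degree `α.degree`, so its coefficient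
  -- there serves as the Taylor coefficient `c α`.
  have hcoeff : ∀ j α, (G j).coeff α = if α.degree = j then (G α.degree).coeff α else 0 := by
    intro j α
    split_ifs with h
    · rw [h]
    · exact (hGh j).coeff_eq_zero h
  have hfin : ∀ (S : Finset (Fin n →₀ ℕ)) (x : Fin n → ℂ),
      HasSum (fun j => ∑ α ∈ S, (G j).coeff α * mono α x)
        (∑ α ∈ S, (G α.degree).coeff α * mono α x) := by
    intro S x
    refine hasSum_sum fun α _ => ?_
    have h := hasSum_ite_eq α.degree ((G α.degree).coeff α * mono α x)
    refine h.congr_fun ?_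
    intro j
    rw [hcoeff j α]
    by_cases hj : j = α.degree
    · simp [hj]
    · rw [if_neg hj, if_neg (Ne.symm hj), zero_mul]
  have hdsum : ∀ S : Finset (Fin n →₀ ℕ),
      DifferentiableOn ℂ (fun x => ∑ α ∈ S, (G α.degree).coeff α * mono α x) U := fun S =>
    (Differentiable.fun_sum fun α _ => (differentiable_mono α).const_mul _).differentiableOn
  refine ⟨fun α => (G α.degree).coeff α, fun k => ?_, fun m hm α hα => ?_, fun S hS => ?_⟩
  · have hdI : DifferentiableOn ℂ
        (fun x => ∫ g, torusChar (-k) g * f (diagAct a g x) ∂(torusMeasure r)) U := by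
      have h := differentiableOn_integral (ν := torusMeasure r) isCompact_univ hU
        (F := fun x g => torusChar (-k) g * f (diagAct a g x)) ?_ fun g _ => ?_
      · simpa using h
      · refine ContinuousOn.mul
          ((continuous_torusChar (-k)).comp continuous_snd).continuousOn ?_
        refine hf.continuousOn.comp
          ((continuous_diagAct a).comp continuous_swap).continuousOn fun p hp => ?_
        exact hinv p.2 _ hp.1
      · exact (hf.comp (differentiable_diagAct a g).differentiableOn (hinv g)).const_mul _
    -- Both sides are holomorphic on `U`, so it is enough to compare them near the origin, where the
    -- expansion converges.
    have h0 := eqOn_zero_of_eventuallyEq hU hUc (hdI.sub (hdsum (hA k).toFinset)) hU0 ?_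
    · exact fun x hx => sub_eq_zero.mp (h0 hx)
    filter_upwards [ball_mem_nhds (0 : Fin n → ℂ) (half_pos hR)] with x hx
    -- The Cauchy estimate at twice the point gains a factor `2 ^ (-j)`, uniformly in `g`, which
    -- justifies exchanging the sum and the torus integral.
    have hx2 : (2 : ℂ) • x ∈ ball (0 : Fin n → ℂ) R := by
      rw [mem_ball_zero_iff] at hx ⊢
      rw [norm_smul, Complex.norm_ofNat]; linarith
    have hxg : ∀ g, diagAct a g x ∈ ball (0 : Fin n → ℂ) R := fun g => by
      rw [mem_ball_zero_iff] at hx ⊢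
      rw [norm_diagAct]; linarith
    have hbound : ∀ j g, ‖torusChar (-k) g * eval (diagAct a g x) (G j)‖ ≤ M * (1 / 2) ^ j := by
      intro j g
      have h1 : (2 : ℂ) • diagAct a g x ∈ ball (0 : Fin n → ℂ) R := by
        rw [mem_ball_zero_iff] at hx2 ⊢
        rwa [norm_smul, norm_diagAct, ← norm_smul]
      have h2 := hGb j _ h1 M fun t ht => hM _ (by
        rw [mem_closedBall_zero_iff, norm_smul, ht, one_mul]
        exact (mem_ball_zero_iff.mp h1).le)
      have h3 : eval ((2 : ℂ) • diagAct a g x) (G j) = 2 ^ j * eval (diagAct a g x) (G j) := by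
        exact eval_smul_of_isHomogeneous (hGh j) _ _
      rw [h3, norm_mul, norm_pow, Complex.norm_ofNat] at h2
      rw [norm_mul, norm_torusChar, one_mul, div_pow, one_pow, mul_one_div,
        le_div_iff₀ (by positivity), mul_comm]
      exact h2
    have hcontj : ∀ j, Continuous fun g => torusChar (-k) g * eval (diagAct a g x) (G j) := by
      intro j
      refine (continuous_torusChar _).mul ((MvPolynomial.continuous_eval (G j)).comp ?_)
      exact (continuous_diagAct a).comp (by fun_prop : Continuous fun g : Torus r => (g, x))
    have hsum := hasSum_integral_of_summable_integral_norm (μ := torusMeasure r)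
      (F := fun j g => torusChar (-k) g * eval (diagAct a g x) (G j))
      (fun j => integrable_torus (hcontj j)) (by
        refine Summable.of_nonneg_of_le (fun j => integral_nonneg fun g => norm_nonneg _)
          (fun j => ?_) ((summable_geometric_two).mul_left M)
        have h4 := norm_integral_le_of_norm_le_const (μ := torusMeasure r)
          (f := fun g => ‖torusChar (-k) g * eval (diagAct a g x) (G j)‖) (C := M * (1 / 2) ^ j)
          (ae_of_all _ fun g => by simpa using hbound j g)
        rw [probReal_univ, mul_one] at h4
        exact (Real.le_norm_self _).trans h4)
    have htsum : ∀ g, ∑' j, torusChar (-k) g * eval (diagAct a g x) (G j) =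
        torusChar (-k) g * f (diagAct a g x) := fun g =>
      ((hGs _ (hxg g)).mul_left _).tsum_eq
    simp_rw [htsum, integral_eval_diagAct] at hsum
    have hsame : ∀ j, ∑ α ∈ (G j).support with wt a α = k, (G j).coeff α * mono α x =
        ∑ α ∈ (hA k).toFinset, (G j).coeff α * mono α x := by
      intro j
      refine Finset.sum_subset (fun α hα => ?_) fun α hα hα' => ?_
      · simpa using (Finset.mem_filter.mp hα).2
      · have h5 : wt a α = k := by simpa using hα
        have h6 : (G j).coeff α = 0 := by
          by_contra h7
          exact hα' (Finset.mem_filter.mpr ⟨mem_support_iff.mpr h7, h5⟩)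
        rw [h6, zero_mul]
    simp_rw [hsame] at hsum
    rw [Pi.zero_apply, Pi.sub_apply, sub_eq_zero]
    exact hsum.unique (hfin _ x)
  · obtain ⟨B, hB⟩ := hm.bound
    obtain ⟨δ, hδ, hδB⟩ := Metric.eventually_nhds_iff_ball.mp hB
    suffices h : G α.degree = 0 by simp [h]
    refine MvPolynomial.funext fun x => ?_
    rw [map_zero, ← norm_le_zero_iff]
    set j := α.degree
    -- The Cauchy estimate at `s • x` bounds `s ^ j * ‖eval x (G j)‖` by `B * (s * ‖x‖) ^ m`; divide
    -- by `s ^ j` and let `s → 0`, using `j < m`.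
    have hlim : Tendsto (fun s : ℝ => B * ‖x‖ ^ m * s ^ (m - j)) (𝓝[>] 0) (𝓝 0) := by
      have h : Continuous fun s : ℝ => B * ‖x‖ ^ m * s ^ (m - j) := by fun_prop
      have h' := h.tendsto 0
      rw [zero_pow (Nat.sub_ne_zero_of_lt hα), mul_zero] at h'
      exact h'.mono_left nhdsWithin_le_nhds
    refine ge_of_tendsto hlim ?_
    have hsmall : ∀ᶠ s : ℝ in 𝓝[>] 0, s * ‖x‖ < min δ R := by
      have h : Continuous fun s : ℝ => s * ‖x‖ := by fun_prop
      have h' := Tendsto.eventually_lt_const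
        (show (0 : ℝ) * ‖x‖ < min δ R by simp [hδ, hR]) (h.tendsto 0)
      exact nhdsWithin_le_nhds h'
    filter_upwards [hsmall, self_mem_nhdsWithin] with s hs (hs0 : 0 < s)
    have hnorm : ‖(s : ℂ) • x‖ = s * ‖x‖ := by
      rw [norm_smul, Complex.norm_real, Real.norm_of_nonneg hs0.le]
    have h1 := hGb j ((s : ℂ) • x) (by
      rw [mem_ball_zero_iff, hnorm]; exact hs.trans_le (min_le_right _ _))
      (B * (s * ‖x‖) ^ m) fun t ht => by
        have h2 : ‖t • (s : ℂ) • x‖ = s * ‖x‖ := by rw [norm_smul, ht, one_mul, hnorm]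
        have h3 := hδB (t • (s : ℂ) • x) (by
          rw [mem_ball_zero_iff, h2]; exact hs.trans_le (min_le_left _ _))
        rwa [h2, Real.norm_of_nonneg (by positivity)] at h3
    rw [eval_smul_of_isHomogeneous (hGh j), norm_mul, norm_pow, Complex.norm_real,
      Real.norm_of_nonneg hs0.le] at h1
    have h4 : s ^ m = s ^ j * s ^ (m - j) := by rw [← pow_add, Nat.add_sub_cancel' hα.le]
    refine le_of_mul_le_mul_left (h1.trans_eq ?_) (pow_pos hs0 j)
    rw [mul_pow, h4]
    ring
  · have h0 := eqOn_zero_of_eventuallyEq hU hUc (hf.sub (hdsum S)) hU0 ?_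
    · exact fun x hx => sub_eq_zero.mp (h0 hx)
    filter_upwards [ball_mem_nhds (0 : Fin n → ℂ) hR] with x hx
    rw [Pi.zero_apply, Pi.sub_apply, sub_eq_zero]
    refine (hGs x hx).unique ?_
    have h := hfin S x
    have hsame : ∀ j, ∑ α ∈ S, (G j).coeff α * mono α x = eval x (G j) := by
      intro j
      rw [eval_eq_sum_mono]
      symm
      refine Finset.sum_subset (fun α hα => ?_) fun α _ hα => ?_
      · by_contra hαS
        have h1 := hcoeff j α
        have h2 : (G α.degree).coeff α = 0 := hS α hαS
        rw [h2, ite_self] at h1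
        exact mem_support_iff.mp hα h1
      · rw [notMem_support_iff.mp hα, zero_mul]
    simpa only [hsame] using h

/-- Against a monomial, a holomorphic function may be replaced by its weight component. -/
theorem integral_mul_conj_mono {a : Fin n → Fin r → ℤ} {U : Set (Fin n → ℂ)} (hU : IsOpen U)
    (hUb : Bornology.IsBounded U) (hinv : ∀ g, ∀ x ∈ U, diagAct a g x ∈ U)
    {f : (Fin n → ℂ) → ℂ} (hf : DifferentiableOn ℂ f U) (hfi : IntegrableOn f U)
    (β : Fin n →₀ ℕ) :
    ∫ x in U, f x * (starRingEnd ℂ) (mono β x) =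
      ∫ x in U, (∫ g, torusChar (-wt a β) g * f (diagAct a g x) ∂(torusMeasure r)) *
        (starRingEnd ℂ) (mono β x) := by
  obtain ⟨B, hB⟩ : ∃ B, ∀ x ∈ U, ‖(starRingEnd ℂ) (mono β x)‖ ≤ B := by
    obtain ⟨B, hB⟩ := hUb.isCompact_closure.exists_bound_of_continuousOn
      (continuous_mono β).continuousOn
    exact ⟨B, fun x hx => by rw [RCLike.norm_conj]; exact hB x (subset_closure hx)⟩
  have hcm : Continuous fun x => (starRingEnd ℂ) (mono β x) :=
    Complex.continuous_conj.comp (continuous_mono β)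
  have hfm : IntegrableOn (fun x => f x * (starRingEnd ℂ) (mono β x)) U := by
    refine Integrable.mul_bdd (c := B) hfi hcm.aestronglyMeasurable ?_
    exact (ae_restrict_iff' hU.measurableSet).mpr (ae_of_all _ hB)
  -- Up to the change of variables `x ↦ diagAct a g x`, which preserves `U` and volume, `Φ g` is the
  -- original integrand. Its integral over `U` is thus independent of `g`; averaging over `g` and
  -- Fubini give the claim.
  let Φ : Torus r → (Fin n → ℂ) → ℂ := fun g x =>
    torusChar (-wt a β) g * f (diagAct a g x) * (starRingEnd ℂ) (mono β x)
  have hΦ : ∀ g x, Φ g x =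
      f (diagAct a g x) * (starRingEnd ℂ) (mono β (diagAct a g x)) := by
    intro g x
    simp only [Φ, mono_diagAct, map_mul, conj_torusChar]
    ring
  have hchange : ∀ {E : Type} [NormedAddCommGroup E] [NormedSpace ℝ E] (g : Torus r)
      (h : (Fin n → ℂ) → E), ∫ x in U, h (diagAct a g x) = ∫ x in U, h x := by
    intro E _ _ g h
    have h1 := (measurePreserving_diagAct a g).setIntegral_preimage_emb
      (measurableEmbedding_diagAct a g) h U
    rwa [preimage_diagAct hinv g] at h1
  have hinner : ∀ g, ∫ x in U, Φ g x = ∫ x in U, f x * (starRingEnd ℂ) (mono β x) := by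
    intro g
    simp_rw [hΦ]
    exact hchange g fun y => f y * (starRingEnd ℂ) (mono β y)
  have hint : Integrable (Function.uncurry Φ) ((torusMeasure r).prod (volume.restrict U)) := by
    have hmeas : AEStronglyMeasurable (Function.uncurry Φ)
        ((torusMeasure r).prod (volume.restrict U)) := by
      have hc : ContinuousOn (Function.uncurry Φ) (univ ×ˢ U) := by
        refine ContinuousOn.mul (ContinuousOn.mul
          ((continuous_torusChar _).comp continuous_fst).continuousOn ?_)
          (hcm.comp continuous_snd).continuousOn
        exact hf.continuousOn.comp (continuous_diagAct a).continuousOn fun p hp =>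
          hinv p.1 _ hp.2
      have h := hc.aestronglyMeasurable (μ := (torusMeasure r).prod volume)
        (MeasurableSet.univ.prod hU.measurableSet)
      rwa [← Measure.prod_restrict, Measure.restrict_univ] at h
    rw [integrable_prod_iff hmeas]
    refine ⟨ae_of_all _ fun g => ?_, ?_⟩
    · simp only [Function.uncurry_apply_pair, hΦ]
      have h1 := (measurePreserving_diagAct a g).integrableOn_comp_preimage
        (measurableEmbedding_diagAct a g) (f := fun y => f y * (starRingEnd ℂ) (mono β y))
        (s := U)
      rw [preimage_diagAct hinv g] at h1
      exact h1.mpr hfm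
    · simp only [Function.uncurry_apply_pair, hΦ]
      have h1 : ∀ g, ∫ x in U, ‖f (diagAct a g x) * (starRingEnd ℂ) (mono β (diagAct a g x))‖ =
          ∫ x in U, ‖f x * (starRingEnd ℂ) (mono β x)‖ := fun g =>
        hchange g fun y => ‖f y * (starRingEnd ℂ) (mono β y)‖
      simp_rw [h1]
      exact integrable_const _
  have hswap := integral_integral_swap hint
  simp_rw [hinner] at hswap
  rw [integral_const, probReal_univ, one_smul] at hswap
  rw [hswap]
  refine integral_congr_ae (ae_of_all _ fun x => ?_)
  exact integral_mul_const _ _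

end DiagonalAction

/-! ### The Jacobian determinant and change of variables -/

section Jacobian

variable {n : ℕ}

/-- The complex Jacobian determinant. -/
def jac (f : (Fin n → ℂ) → (Fin n → ℂ)) (x : Fin n → ℂ) : ℂ := (fderiv ℂ f x).det

lemma differentiableOn_jac {U : Set (Fin n → ℂ)} (hU : IsOpen U)
    {f : (Fin n → ℂ) → (Fin n → ℂ)} (hf : DifferentiableOn ℂ f U) :
    DifferentiableOn ℂ (jac f) U := by
  have h : jac f = fun x => (LinearMap.toMatrix' (fderiv ℂ f x : (Fin n → ℂ) →ₗ[ℂ] _)).det := by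
    funext x
    rw [LinearMap.det_toMatrix']
    rfl
  rw [h]
  simp only [Matrix.det_apply, LinearMap.toMatrix'_apply]
  refine DifferentiableOn.fun_sum fun σ _ => DifferentiableOn.const_smul ?_ _
  have hent : ∀ i j : Fin n, DifferentiableOn ℂ
      (fun x => (fderiv ℂ f x : (Fin n → ℂ) →ₗ[ℂ] (Fin n → ℂ)) (Pi.single j 1) i) U := fun i j =>
    differentiableOn_pi.mp (differentiableOn_fderiv_apply hU hf _) i
  exact fun x hx => (HasFDerivWithinAt.finsetProd fun i _ =>
    (hent (σ i) i x hx).hasFDerivWithinAt).differentiableWithinAt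

/-- The real determinant of a complex-linear map is the norm from `ℂ` to `ℝ` of its complex
determinant. -/
lemma abs_det_restrictScalars (A : (Fin n → ℂ) →L[ℂ] (Fin n → ℂ)) :
    |(A.restrictScalars ℝ).det| = ‖A.det‖ ^ 2 := by
  have h : (A.restrictScalars ℝ).det = Algebra.norm ℝ A.det :=
    LinearMap.det_restrictScalars (R := ℝ) (f := (A : (Fin n → ℂ) →ₗ[ℂ] (Fin n → ℂ)))
  rw [h, Algebra.norm_complex_apply, Complex.normSq_eq_norm_sq, abs_of_nonneg (sq_nonneg _)]

lemma hasFDerivWithinAt_real {U : Set (Fin n → ℂ)} (hU : IsOpen U)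
    {f : (Fin n → ℂ) → (Fin n → ℂ)} (hf : DifferentiableOn ℂ f U) :
    ∀ x ∈ U, HasFDerivWithinAt f ((fderiv ℂ f x).restrictScalars ℝ) U x := fun _ hx =>
  ((hf.differentiableAt (hU.mem_nhds hx)).hasFDerivAt.restrictScalars ℝ).hasFDerivWithinAt

variable {U U' : Set (Fin n → ℂ)} {f F : (Fin n → ℂ) → (Fin n → ℂ)}

lemma integral_image_jac (hU : IsOpen U) (hf : DifferentiableOn ℂ f U) (hm : MapsTo f U U')
    (hF : MapsTo F U' U) (hi : InvOn F f U U') (h : (Fin n → ℂ) → ℂ) :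
    ∫ y in U', h y = ∫ x in U, ((‖jac f x‖ ^ 2 : ℝ) : ℂ) * h (f x) := by
  have h1 := integral_image_eq_integral_abs_det_fderiv_smul volume hU.measurableSet
    (hasFDerivWithinAt_real hU hf) hi.1.injOn h
  rw [(hi.bijOn hm hF).image_eq] at h1
  simp_rw [abs_det_restrictScalars] at h1
  simpa [jac] using h1

/-- The integral of `‖jac f‖ ^ 2` is the volume of `U'`; the inequality `t ≤ t ^ 2 + 1` and
boundedness of `U` pass from square integrability to integrability. -/
lemma integrableOn_jac (hU : IsOpen U) (hU' : Bornology.IsBounded U')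
    (hf : DifferentiableOn ℂ f U) (hUb : Bornology.IsBounded U) (hm : MapsTo f U U')
    (hF : MapsTo F U' U) (hi : InvOn F f U U') : IntegrableOn (jac f) U := by
  have h1 := integrableOn_image_iff_integrableOn_abs_det_fderiv_smul volume hU.measurableSet
    (hasFDerivWithinAt_real hU hf) hi.1.injOn (fun _ => (1 : ℝ))
  rw [(hi.bijOn hm hF).image_eq] at h1
  simp_rw [abs_det_restrictScalars] at h1
  have h2 := h1.mp (integrableOn_const hU'.measure_lt_top.ne)
  refine Integrable.mono' (h2.add (integrableOn_const (C := (1 : ℝ)) hUb.measure_lt_top.ne))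
    ((differentiableOn_jac hU hf).continuousOn.aestronglyMeasurable hU.measurableSet)
    (ae_of_all _ fun x => ?_)
  simp only [Pi.add_apply, smul_eq_mul, mul_one]
  change ‖jac f x‖ ≤ ‖jac f x‖ ^ 2 + 1
  nlinarith [sq_nonneg (‖jac f x‖ - 1), norm_nonneg (jac f x)]

lemma jac_mul_jac (hU : IsOpen U) (hU' : IsOpen U') (hf : DifferentiableOn ℂ f U)
    (hFd : DifferentiableOn ℂ F U') (hm : MapsTo f U U') (hi : LeftInvOn F f U)
    {x : Fin n → ℂ} (hx : x ∈ U) : jac F (f x) * jac f x = 1 := by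
  have h1 := (hFd.differentiableAt (hU'.mem_nhds (hm hx))).hasFDerivAt.comp x
    (hf.differentiableAt (hU.mem_nhds hx)).hasFDerivAt
  have h2 : HasFDerivAt (F ∘ f) (ContinuousLinearMap.id ℂ (Fin n → ℂ)) x := by
    refine (hasFDerivAt_id x).congr_of_eventuallyEq ?_
    filter_upwards [hU.mem_nhds hx] with y hy using hi hy
  have h3 := h1.unique h2
  have h4 : LinearMap.det ((fderiv ℂ F (f x) : (Fin n → ℂ) →ₗ[ℂ] (Fin n → ℂ)) ∘ₗ
      (fderiv ℂ f x : (Fin n → ℂ) →ₗ[ℂ] (Fin n → ℂ))) = 1 := by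
    rw [← ContinuousLinearMap.toLinearMap_comp, h3]
    exact LinearMap.det_id
  rw [LinearMap.det_comp] at h4
  exact h4

end Jacobian

/-! ### The orthogonality argument on diagonal domains -/

section DiagonalDomains

variable {r s n : ℕ}

/-- Bounded domains containing the origin, invariant under the diagonal action with weights `a`. -/
structure IsDiagDomain (a : Fin n → Fin r → ℤ) (U : Set (Fin n → ℂ)) : Prop where
  isOpen : IsOpen U
  isPreconnected : IsPreconnected U
  zero_mem : 0 ∈ U
  isBounded : Bornology.IsBounded U
  invariant : ∀ g, ∀ x ∈ U, diagAct a g x ∈ U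

lemma eq_zero_of_sum_mono_eq_zero {U : Set (Fin n → ℂ)} (hU : IsOpen U) (hU0 : 0 ∈ U)
    (S : Finset (Fin n →₀ ℕ)) (c : (Fin n →₀ ℕ) → ℂ)
    (h : ∀ x ∈ U, ∑ α ∈ S, c α * mono α x = 0) : ∀ α ∈ S, c α = 0 := by
  classical
  obtain ⟨R, hR, hRU⟩ := Metric.nhds_basis_ball.mem_iff.mp (hU.mem_nhds hU0)
  have hP : ∑ α ∈ S, monomial α (c α) = 0 := by
    refine MvPolynomial.funext_set (fun _ => ball (0 : ℂ) R) (fun i => ?_) fun x hx => ?_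
    · exact infinite_of_mem_nhds 0 (ball_mem_nhds _ hR)
    · have hxU : x ∈ U := hRU (by rw [ball_pi _ hR]; exact hx)
      rw [map_sum, map_zero, ← h x hxU]
      exact Finset.sum_congr rfl fun α _ => eval_monomial_eq_mono _ _ _
  intro α hα
  have := congrArg (coeff α) hP
  simpa [coeff_sum, coeff_monomial, hα] using this

/-- A polynomial orthogonal to each of its monomials is orthogonal to itself, so it vanishes almost
everywhere on `U`, and everywhere there by continuity. -/
lemma eq_zero_of_integral_conj_mono_eq_zero {U : Set (Fin n → ℂ)} (hU : IsOpen U) (hU0 : 0 ∈ U)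
    (hUb : Bornology.IsBounded U) (S : Finset (Fin n →₀ ℕ)) (c : (Fin n →₀ ℕ) → ℂ)
    (h : ∀ β ∈ S, ∫ x in U, (∑ α ∈ S, c α * mono α x) * (starRingEnd ℂ) (mono β x) = 0) :
    ∀ α ∈ S, c α = 0 := by
  set p : (Fin n → ℂ) → ℂ := fun x => ∑ α ∈ S, c α * mono α x with hp
  have hpc : Continuous p := continuous_finsetSum _ fun α _ => (continuous_mono α).const_mul _
  have hint : ∀ {E : Type} [NormedAddCommGroup E] {q : (Fin n → ℂ) → E}, Continuous q →
      IntegrableOn q U := fun hq =>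
    (hq.continuousOn.integrableOn_compact hUb.isCompact_closure).mono_set subset_closure
  have h1 : ∫ x in U, p x * (starRingEnd ℂ) (p x) = 0 := by
    have h2 : ∀ x, p x * (starRingEnd ℂ) (p x) =
        ∑ β ∈ S, (starRingEnd ℂ) (c β) * (p x * (starRingEnd ℂ) (mono β x)) := by
      intro x
      conv_lhs => rw [show (starRingEnd ℂ) (p x) = ∑ β ∈ S, (starRingEnd ℂ) (c β) *
        (starRingEnd ℂ) (mono β x) by simp [hp], Finset.mul_sum]
      exact Finset.sum_congr rfl fun β _ => by ring
    simp_rw [h2]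
    have hci : ∀ β, Continuous fun x =>
        (starRingEnd ℂ) (c β) * (p x * (starRingEnd ℂ) (mono β x)) := fun β => by
      have := continuous_mono β
      fun_prop
    rw [integral_finsetSum _ fun β _ => hint (hci β)]
    refine Finset.sum_eq_zero fun β hβ => ?_
    rw [integral_const_mul, h β hβ, mul_zero]
  have h3 : ∫ x in U, ‖p x‖ ^ 2 = 0 := by
    simp_rw [Complex.mul_conj'] at h1
    have h4 : ∫ x in U, (((‖p x‖ ^ 2 : ℝ)) : ℂ) = 0 := by simpa using h1
    rw [integral_complex_ofReal] at h4
    exact_mod_cast h4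
  rw [integral_eq_zero_iff_of_nonneg (fun x => by positivity) (hint (by fun_prop))] at h3
  have h5 := Measure.eqOn_open_of_ae_eq h3 hU (by fun_prop) continuousOn_const
  refine eq_zero_of_sum_mono_eq_zero hU hU0 S c fun x hx => ?_
  simpa using h5 hx

lemma finite_wt_of_degree_le {a : Fin n → Fin r → ℤ} (hA : ∀ k, {α | wt a α = k}.Finite) (m : ℕ) :
    {α : Fin n →₀ ℕ | ∃ β : Fin n →₀ ℕ, wt a β = wt a α ∧ β.degree ≤ m}.Finite := by
  refine ((Finsupp.finite_of_degree_le (σ := Fin n) m).biUnion fun β _ => hA (wt a β)).subset ?_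
  rintro α ⟨β, hβ, hm⟩
  exact mem_biUnion (show β ∈ {β : Fin n →₀ ℕ | β.degree ≤ m} from hm) hβ.symm

/-- The pull-back of a monomial, as a holomorphic form of top degree, under a biholomorphism of
invariant domains is a polynomial. -/
theorem exists_polynomial_mono_comp_mul_jac {a : Fin n → Fin r → ℤ} {a' : Fin n → Fin s → ℤ}
    (hA : ∀ k, {α | wt a α = k}.Finite) (hA' : ∀ k, {α | wt a' α = k}.Finite)
    {U U' : Set (Fin n → ℂ)} (hU : IsDiagDomain a U) (hU' : IsDiagDomain a' U')
    {f F : (Fin n → ℂ) → (Fin n → ℂ)} (hf : DifferentiableOn ℂ f U)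
    (hF : DifferentiableOn ℂ F U') (hfm : MapsTo f U U') (hFm : MapsTo F U' U)
    (hi : InvOn F f U U') (hf0 : f 0 = 0) (γ : Fin n →₀ ℕ) (m : ℕ)
    (hm : ∀ γ', wt a' γ' = wt a' γ → γ'.degree ≤ m) :
    ∃ (S : Finset (Fin n →₀ ℕ)) (c : (Fin n →₀ ℕ) → ℂ),
      (∀ α ∈ S, ∃ β, wt a β = wt a α ∧ β.degree ≤ m) ∧
        ∀ x ∈ U, mono γ (f x) * jac f x = ∑ α ∈ S, c α * mono α x := by
  have hbdd : ∀ {V V' : Set (Fin n → ℂ)} {h H : (Fin n → ℂ) → (Fin n → ℂ)} (α : Fin n →₀ ℕ),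
      IsOpen V → Bornology.IsBounded V → Bornology.IsBounded V' → DifferentiableOn ℂ h V →
      MapsTo h V V' → MapsTo H V' V → InvOn H h V V' →
      IntegrableOn (fun x => mono α (h x) * jac h x) V := by
    intro V V' h H α hV hVb hVb' hh hhm hHm hhi
    obtain ⟨B, hB⟩ := hVb'.isCompact_closure.exists_bound_of_continuousOn
      (continuous_mono α).continuousOn
    refine Integrable.bdd_mul (c := B) (integrableOn_jac hV hVb' hh hVb hhm hHm hhi) ?_ ?_
    · exact ((continuous_mono α).comp_continuousOn hh.continuousOn).aestronglyMeasurable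
        hV.measurableSet
    · exact (ae_restrict_iff' hV.measurableSet).mpr
        (ae_of_all _ fun x hx => hB _ (subset_closure (hhm hx)))
  have hgd : DifferentiableOn ℂ (fun x => mono γ (f x) * jac f x) U :=
    ((differentiable_mono γ).comp_differentiableOn hf).mul (differentiableOn_jac hU.isOpen hf)
  have hgi := hbdd γ hU.isOpen hU.isBounded hU'.isBounded hf hfm hFm hi
  have hF0 : F 0 = 0 := by
    have := hi.1 hU.zero_mem
    rwa [hf0] at this
  -- The heart of the proof: on the target, `F^β · jac F` vanishes to order `β.degree > m` at the
  -- origin, while its component of weight `wt a' γ` has degree at most `m`.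
  have horth : ∀ β : Fin n →₀ ℕ, m < β.degree →
      ∫ x in U, mono γ (f x) * jac f x * (starRingEnd ℂ) (mono β x) = 0 := by
    intro β hβ
    have hqd : DifferentiableOn ℂ (fun y => mono β (F y) * jac F y) U' :=
      ((differentiable_mono β).comp_differentiableOn hF).mul (differentiableOn_jac hU'.isOpen hF)
    have hqi := hbdd β hU'.isOpen hU'.isBounded hU.isBounded hF hFm hfm hi.symm
    have hconj : ∫ x in U, mono γ (f x) * jac f x * (starRingEnd ℂ) (mono β x) =
        (starRingEnd ℂ) (∫ y in U', mono β (F y) * jac F y * (starRingEnd ℂ) (mono γ y)) := by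
      rw [integral_image_jac hU'.isOpen hF hFm hfm hi.symm, ← integral_conj]
      refine setIntegral_congr_fun hU'.isOpen.measurableSet fun y hy => ?_
      -- The factor `jac f (F y)` cancels one of the two factors in `‖jac F y‖ ^ 2`, leaving the
      -- conjugate of `jac F y`.
      have hj := jac_mul_jac hU'.isOpen hU.isOpen hF hf hFm hi.2 hy
      simp only [hi.2 hy, map_mul, Complex.conj_conj]
      rw [show ((‖jac F y‖ ^ 2 : ℝ) : ℂ) = jac F y * (starRingEnd ℂ) (jac F y) by
        rw [Complex.mul_conj']; push_cast; rfl]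
      linear_combination (starRingEnd ℂ) (jac F y) * mono γ y * (starRingEnd ℂ) (mono β (F y)) * hj
    obtain ⟨c, hc1, hc2, -⟩ := exists_weight_expansion hA' hU'.isOpen hU'.isPreconnected
      hU'.zero_mem hU'.invariant hqd
    have hO : (fun y => mono β (F y) * jac F y) =O[𝓝 0] fun y => ‖y‖ ^ β.degree := by
      have h1 : (fun y => mono β (F y)) =O[𝓝 0] fun y => ‖y‖ ^ β.degree := by
        have h2 := (hF.differentiableAt (hU'.isOpen.mem_nhds hU'.zero_mem)).isBigO_sub
        simp only [hF0, sub_zero] at h2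
        refine Asymptotics.IsBigO.trans ?_ (h2.norm_norm.pow β.degree)
        exact Asymptotics.isBigO_of_le _ fun y => (norm_mono_le β (F y)).trans (Real.le_norm_self _)
      have h3 : jac F =O[𝓝 0] fun _ => (1 : ℝ) :=
        (((differentiableOn_jac hU'.isOpen hF).differentiableAt
          (hU'.isOpen.mem_nhds hU'.zero_mem)).continuousAt).isBigO_one ℝ
      simpa using h1.mul h3
    rw [hconj, integral_mul_conj_mono hU'.isOpen hU'.isBounded hU'.invariant hqd hqi]
    rw [setIntegral_eq_zero_of_forall_eq_zero, map_zero]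
    intro y hy
    rw [hc1 _ y hy, Finset.sum_eq_zero, zero_mul]
    intro α hα
    have hα' : wt a' α = wt a' γ := by simpa using hα
    rw [hc2 _ hO α ((hm α hα').trans_lt hβ), zero_mul]
  obtain ⟨c, hc1, -, hc3⟩ := exists_weight_expansion hA hU.isOpen hU.isPreconnected
    hU.zero_mem hU.invariant hgd
  refine ⟨(finite_wt_of_degree_le hA m).toFinset, c, fun α hα => by simpa using hα,
    hc3 _ fun α hα => ?_⟩
  -- Every monomial of the weight of `α` now has degree above `m`, so the whole weight component is
  -- orthogonal to its own monomials.
  have hα' : ∀ β, wt a β = wt a α → m < β.degree := by simpa using hα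
  refine eq_zero_of_integral_conj_mono_eq_zero hU.isOpen hU.zero_mem hU.isBounded
    (hA (wt a α)).toFinset c (fun β hβ => ?_) α (by simp)
  have hβ' : wt a β = wt a α := by simpa using hβ
  rw [← horth β (hα' β hβ'), integral_mul_conj_mono hU.isOpen hU.isBounded hU.invariant hgd hgi]
  refine setIntegral_congr_fun hU.isOpen.measurableSet fun x hx => ?_
  simp only [hβ', hc1 _ x hx]

/-- Biholomorphisms of invariant domains fixing the origin are polynomial, with control on the
monomials that occur. -/
theorem exists_polynomial_component {a : Fin n → Fin r → ℤ} {a' : Fin n → Fin s → ℤ}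
    (hA : ∀ k, {α | wt a α = k}.Finite) (hA' : ∀ k, {α | wt a' α = k}.Finite)
    (ha : ∀ α, wt a α = 0 → α = 0) (ha' : ∀ α, wt a' α = 0 → α = 0)
    {U U' : Set (Fin n → ℂ)} (hU : IsDiagDomain a U) (hU' : IsDiagDomain a' U')
    {f F : (Fin n → ℂ) → (Fin n → ℂ)} (hf : DifferentiableOn ℂ f U)
    (hF : DifferentiableOn ℂ F U') (hfm : MapsTo f U U') (hFm : MapsTo F U' U)
    (hi : InvOn F f U U') (hf0 : f 0 = 0) (i : Fin n) (m : ℕ)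
    (hm : ∀ γ, wt a' γ = a' i → γ.degree ≤ m) :
    ∃ (S : Finset (Fin n →₀ ℕ)) (c : (Fin n →₀ ℕ) → ℂ),
      (∀ α ∈ S, ∃ β, wt a β = wt a α ∧ β.degree ≤ m) ∧
        ∀ x ∈ U, f x i = ∑ α ∈ S, c α * mono α x := by
  -- With `γ = 0` and `m = 0` only weight zero survives, hence only the constant monomial: the
  -- Jacobian is constant.
  obtain ⟨S₀, c₀, hS₀, h₀⟩ := exists_polynomial_mono_comp_mul_jac hA hA' hU hU' hf hF hfm hFm hi
    hf0 0 0 fun γ hγ => by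
      rw [wt_zero] at hγ
      rw [ha' γ hγ, map_zero]
  have hconst : ∀ x ∈ U, jac f x = jac f 0 := by
    have h1 : ∀ α ∈ S₀, α = 0 := fun α hα => by
      obtain ⟨β, hβ, hβ0⟩ := hS₀ α hα
      rw [Nat.le_zero, Finsupp.degree_eq_zero_iff] at hβ0
      subst hβ0
      rw [wt_zero] at hβ
      exact ha α hβ.symm
    have h2 : ∀ x ∈ U, jac f x = ∑ α ∈ S₀, c₀ α := fun x hx => by
      have h3 := h₀ x hx
      rw [mono_zero, one_mul] at h3
      rw [h3]
      exact Finset.sum_congr rfl fun α hα => by rw [h1 α hα, mono_zero, mul_one]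
    exact fun x hx => (h2 x hx).trans (h2 0 hU.zero_mem).symm
  have hne : jac f 0 ≠ 0 := right_ne_zero_of_mul_eq_one
    (jac_mul_jac hU.isOpen hU'.isOpen hf hF hfm hi.1 hU.zero_mem)
  obtain ⟨S, c, hS, h⟩ := exists_polynomial_mono_comp_mul_jac hA hA' hU hU' hf hF hfm hFm hi
    hf0 (Finsupp.single i 1) m fun γ hγ => hm γ (by rwa [wt_single] at hγ)
  refine ⟨S, fun α => (jac f 0)⁻¹ * c α, hS, fun x hx => ?_⟩
  have h1 := h x hx
  rw [mono_single, hconst x hx] at h1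
  simp_rw [mul_assoc, ← Finset.mul_sum, ← h1]
  field_simp

end DiagonalDomains

/-! ### Degrees under linear changes of coordinates -/

section LinearSubstitution

variable {n : ℕ}

lemma totalDegree_bind₁_le {L : Fin n → MvPolynomial (Fin n) ℂ} (hL : ∀ i, (L i).totalDegree ≤ 1)
    (p : MvPolynomial (Fin n) ℂ) : (bind₁ L p).totalDegree ≤ p.totalDegree := by
  conv_lhs => rw [p.as_sum, map_sum]
  refine totalDegree_finsetSum_le fun α hα => ?_
  rw [bind₁_monomial]
  refine (totalDegree_mul _ _).trans ?_
  rw [totalDegree_C, zero_add]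
  refine (totalDegree_finsetProd _ _).trans (le_trans ?_ (le_totalDegree hα))
  refine Finset.sum_le_sum fun i _ => (totalDegree_pow _ _).trans ?_
  exact (Nat.mul_le_mul_left _ (hL i)).trans_eq (mul_one _)

/-- The `i`-th coordinate of a linear map, as a polynomial. -/
def linPoly (A : (Fin n → ℂ) →ₗ[ℂ] (Fin n → ℂ)) (i : Fin n) : MvPolynomial (Fin n) ℂ :=
  ∑ j, C (A (Pi.single j 1) i) * X j

lemma eval_linPoly (A : (Fin n → ℂ) →ₗ[ℂ] (Fin n → ℂ)) (i : Fin n) (z : Fin n → ℂ) :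
    eval z (linPoly A i) = A z i := by
  conv_rhs => rw [pi_eq_sum_univ' z, map_sum]
  simp [linPoly, mul_comm]

lemma isHomogeneous_linPoly (A : (Fin n → ℂ) →ₗ[ℂ] (Fin n → ℂ)) (i : Fin n) :
    (linPoly A i).IsHomogeneous 1 :=
  IsHomogeneous.sum _ _ _ fun j _ => (isHomogeneous_X ℂ j).C_mul _

lemma eval_bind₁_linPoly (A : (Fin n → ℂ) →ₗ[ℂ] (Fin n → ℂ)) (p : MvPolynomial (Fin n) ℂ)
    (z : Fin n → ℂ) : eval z (bind₁ (linPoly A) p) = eval (A z) p := by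
  rw [← coe_aeval_eq_eval, RingHom.coe_coe, aeval_bind₁, ← coe_aeval_eq_eval, RingHom.coe_coe]
  congr 2
  funext i
  exact eval_linPoly A i z

lemma totalDegree_bind₁_linPoly_le (A : (Fin n → ℂ) →ₗ[ℂ] (Fin n → ℂ))
    (p : MvPolynomial (Fin n) ℂ) : (bind₁ (linPoly A) p).totalDegree ≤ p.totalDegree :=
  totalDegree_bind₁_le (fun i => (isHomogeneous_linPoly A i).totalDegree_le) p

lemma totalDegree_bind₁_linPoly (A : (Fin n → ℂ) ≃ₗ[ℂ] (Fin n → ℂ)) (p : MvPolynomial (Fin n) ℂ) :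
    (bind₁ (linPoly (A : (Fin n → ℂ) →ₗ[ℂ] (Fin n → ℂ))) p).totalDegree = p.totalDegree := by
  refine le_antisymm (totalDegree_bind₁_linPoly_le _ p) ?_
  have h : p = bind₁ (linPoly (A.symm : (Fin n → ℂ) →ₗ[ℂ] (Fin n → ℂ)))
      (bind₁ (linPoly (A : (Fin n → ℂ) →ₗ[ℂ] (Fin n → ℂ))) p) := by
    refine MvPolynomial.funext fun z => ?_
    simp [eval_bind₁_linPoly]
  conv_lhs => rw [h]
  exact totalDegree_bind₁_linPoly_le _ _

end LinearSubstitution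

/-! ### Weight spaces in terms of monomials -/

section Weights

variable {r n : ℕ} {ρ : TorusAction r n} {b : Module.Basis (Fin n) ℂ (Fin n → ℂ)}
  {a : Fin n → Fin r → ℤ}

lemma IsWeightBasis.equivFun_act (hb : IsWeightBasis ρ b a) (g : Torus r) (z : Fin n → ℂ) :
    b.equivFun (act ρ g z) = diagAct a g (b.equivFun z) := by
  have h : (b.equivFun : (Fin n → ℂ) →ₗ[ℂ] (Fin n → ℂ)) ∘ₗ actLin ρ g =
      LinearMap.pi (fun i => torusChar (a i) g • LinearMap.proj i) ∘ₗ
        (b.equivFun : (Fin n → ℂ) →ₗ[ℂ] (Fin n → ℂ)) := by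
    refine b.ext fun i => ?_
    funext j
    simp only [LinearMap.comp_apply, actLin_apply, hb g i, map_smul, LinearEquiv.coe_coe,
      Module.Basis.equivFun_self, Pi.smul_apply, LinearMap.pi_apply, LinearMap.smul_apply,
      LinearMap.proj_apply, smul_eq_mul]
    by_cases hij : i = j
    · subst hij; simp
    · simp [hij]
  exact LinearMap.congr_fun h z

lemma IsWeightBasis.act_symm (hb : IsWeightBasis ρ b a) (g : Torus r) (x : Fin n → ℂ) :
    b.equivFun.symm (diagAct a g x) = act ρ g (b.equivFun.symm x) := by
  rw [LinearEquiv.symm_apply_eq, hb.equivFun_act, LinearEquiv.apply_symm_apply]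

/-- A monomial of weight zero is invariant, hence constant; its values at the origin and at `(1, …,
1)` differ unless `α = 0`. -/
lemma IsWeightBasis.eq_zero_of_wt_eq_zero (hb : IsWeightBasis ρ b a)
    (hρ : OnlyConstantInvariants ρ) (α : Fin n →₀ ℕ) (hα : wt a α = 0) : α = 0 := by
  obtain ⟨c, hc⟩ := hρ (fun z => mono α (b.equivFun z))
    ((differentiable_mono α).comp (b.equivFunL : (Fin n → ℂ) →L[ℂ] (Fin n → ℂ)).differentiable)
    fun g z => by rw [hb.equivFun_act, mono_diagAct, hα, torusChar_zero, one_mul]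
  have h := (hc 0).trans (hc (b.equivFun.symm fun _ => 1)).symm
  rw [map_zero, LinearEquiv.apply_symm_apply] at h
  by_contra hne
  obtain ⟨i, hi⟩ := Finsupp.ne_iff.mp hne
  rw [mono, Finset.prod_eq_zero (Finset.mem_univ i) (by simpa using hi)] at h
  simp [mono] at h

/-- Dickson's lemma: two comparable exponents of equal weight differ by one of weight zero, so the
fibre is an antichain in a well-quasi-order. -/
lemma finite_wt_eq (ha : ∀ α, wt a α = 0 → α = 0) (k : Fin r → ℤ) : {α | wt a α = k}.Finite := by
  refine IsAntichain.finite_of_partiallyWellOrderedOn (r := (· ≤ ·)) ?_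
    (isPWO_of_wellQuasiOrderedLE _)
  intro α hα β hβ hne hle
  obtain ⟨δ, rfl⟩ := exists_add_of_le hle
  rw [mem_ofPred_eq] at hα hβ
  rw [wt_add, hα, add_eq_left] at hβ
  exact hne (by rw [ha δ hβ, add_zero])

lemma IsWeightBasis.weightDegrees_eq (hb : IsWeightBasis ρ b a) (k : Fin r → ℤ) :
    weightDegrees ρ k = Finsupp.degree '' {α : Fin n →₀ ℕ | wt a α = k} := by
  ext d
  constructor
  · rintro ⟨p, hp, hp0, rfl⟩
    set q := bind₁ (linPoly (b.equivFun.symm : (Fin n → ℂ) →ₗ[ℂ] (Fin n → ℂ))) p with hq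
    have hqd : q.totalDegree = p.totalDegree := totalDegree_bind₁_linPoly b.equivFun.symm p
    have hqe : ∀ x, eval x q = eval (b.equivFun.symm x) p := eval_bind₁_linPoly _ p
    have hq0 : q ≠ 0 := fun h => hp0 <| MvPolynomial.funext fun z => by
      have := hqe (b.equivFun z)
      rw [h, LinearEquiv.symm_apply_apply] at this
      rw [← this, map_zero, map_zero]
    -- Averaging against the character of `-k` fixes `q` but also projects it to its weight-`k`
    -- part, so the remaining terms sum to zero.
    have hwt : ∀ α ∈ q.support, wt a α = k := by
      have h1 : ∀ x, ∑ α ∈ q.support with ¬ wt a α = k, q.coeff α * mono α x = 0 := by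
        intro x
        have h2 := integral_eval_diagAct a k q x
        have h3 : ∀ g : Torus r, torusChar (-k) g * eval (diagAct a g x) q = eval x q := by
          intro g
          rw [hqe, hqe, hb.act_symm, hp g, ← mul_assoc, ← torusChar_add, neg_add_cancel,
            torusChar_zero, one_mul]
        simp_rw [h3] at h2
        rw [MeasureTheory.integral_const, MeasureTheory.probReal_univ, one_smul,
          eval_eq_sum_mono, ← Finset.sum_filter_add_sum_filter_not q.support (fun α => wt a α = k)]
          at h2
        exact add_eq_left.mp h2
      intro α hα
      by_contra hne
      exact mem_support_iff.mp hα (eq_zero_of_sum_mono_eq_zero isOpen_univ (mem_univ _) _ _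
        (fun x _ => h1 x) α (Finset.mem_filter.mpr ⟨hα, hne⟩))
    obtain ⟨α, hα, hαd⟩ := Finset.exists_mem_eq_sup q.support (support_nonempty.mpr hq0)
      fun α => α.degree
    refine ⟨α, hwt α hα, ?_⟩
    rw [← hqd, ← hαd]
    rfl
  · rintro ⟨α, rfl, rfl⟩
    have hdeg : (bind₁ (linPoly (b.equivFun : (Fin n → ℂ) →ₗ[ℂ] (Fin n → ℂ)))
        (monomial α (1 : ℂ))).totalDegree = α.degree := by
      rw [totalDegree_bind₁_linPoly, totalDegree_monomial _ one_ne_zero]; rfl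
    have hev : ∀ z, eval z (bind₁ (linPoly (b.equivFun : (Fin n → ℂ) →ₗ[ℂ] (Fin n → ℂ)))
        (monomial α (1 : ℂ))) = mono α (b.equivFun z) := fun z => by
      rw [eval_bind₁_linPoly, eval_monomial_eq_mono, one_mul]; rfl
    refine ⟨_, fun g z => ?_, fun h => ?_, hdeg⟩
    · rw [hev, hev, hb.equivFun_act, mono_diagAct]
    · have h1 := hev (b.equivFun.symm fun _ => 1)
      rw [h, LinearEquiv.apply_symm_apply] at h1
      simp [mono] at h1

lemma weightSpace_ne_bot_iff (hb : IsWeightBasis ρ b a) (k : Fin r → ℤ) : weightSpace ρ k ≠ ⊥ ↔ ∃ α, wt a α = k := by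
  have h : weightSpace ρ k ≠ ⊥ ↔ (weightDegrees ρ k).Nonempty := by
    rw [Submodule.ne_bot_iff]
    exact ⟨fun ⟨p, hp, hp0⟩ => ⟨_, p, hp, hp0, rfl⟩, fun ⟨_, p, hp, hp0, _⟩ => ⟨p, hp, hp0⟩⟩
  rw [h, hb.weightDegrees_eq, image_nonempty]
  rfl

/-- Finiteness of the fibre is essential: `sSup` of an unbounded set of naturals is `0`. -/
lemma degree_le_maxDegree (hb : IsWeightBasis ρ b a) (hρ : OnlyConstantInvariants ρ)
    {k : Fin r → ℤ} {α : Fin n →₀ ℕ} (hα : wt a α = k) :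
    α.degree ≤ maxDegree ρ k := by
  refine le_csSup ?_ ?_
  · rw [hb.weightDegrees_eq]
    exact ((finite_wt_eq (hb.eq_zero_of_wt_eq_zero hρ) k).image _).bddAbove
  · rw [hb.weightDegrees_eq]
    exact mem_image_of_mem _ hα

lemma minDegree_le (hb : IsWeightBasis ρ b a) {k : Fin r → ℤ} {α : Fin n →₀ ℕ} (hα : wt a α = k) :
    minDegree ρ k ≤ α.degree := by
  refine Nat.sInf_le ?_
  rw [hb.weightDegrees_eq]
  exact mem_image_of_mem _ hα

lemma exists_degree_eq_minDegree (hb : IsWeightBasis ρ b a) {k : Fin r → ℤ} (hk : weightSpace ρ k ≠ ⊥) :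
    ∃ α, wt a α = k ∧ α.degree = minDegree ρ k := by
  obtain ⟨α, hα⟩ := (weightSpace_ne_bot_iff hb k).mp hk
  have h : minDegree ρ k ∈ weightDegrees ρ k := Nat.sInf_mem (by
    rw [hb.weightDegrees_eq]; exact ⟨_, mem_image_of_mem _ hα⟩)
  rwa [hb.weightDegrees_eq] at h

lemma finite_minDegree_le (hb : IsWeightBasis ρ b a) (m : ℕ) : {k | weightSpace ρ k ≠ ⊥ ∧ minDegree ρ k ≤ m}.Finite := by
  refine ((Finsupp.finite_of_degree_le (σ := Fin n) m).image (wt a)).subset ?_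
  rintro k ⟨hk, hm⟩
  obtain ⟨α, hα, hd⟩ := exists_degree_eq_minDegree hb hk
  exact ⟨α, hd.trans_le hm, hα⟩

lemma degree_le_maxDegreeOfMinLE (hb : IsWeightBasis ρ b a) (hρ : OnlyConstantInvariants ρ)
    {m : ℕ} {α β : Fin n →₀ ℕ} (hβ : wt a β = wt a α)
    (hm : β.degree ≤ m) : α.degree ≤ maxDegreeOfMinLE ρ m := by
  refine (degree_le_maxDegree hb hρ rfl).trans (le_csSup ?_ ?_)
  · exact ((finite_minDegree_le hb m).image _).bddAbove
  · exact mem_image_of_mem _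
      ⟨(weightSpace_ne_bot_iff hb _).mpr ⟨α, rfl⟩, (minDegree_le hb hβ).trans hm⟩

/-- The `i`-th coordinate has weight `a i` and degree `1`. Minimal degree `0` would mean `a i = 0`,
making that coordinate a nonconstant invariant. -/
lemma resonanceOrderAt_le_resonanceOrder (hb : IsWeightBasis ρ b a) (hρ : OnlyConstantInvariants ρ)
    (i : Fin n) :
    resonanceOrderAt ρ a i ≤ resonanceOrder ρ := by
  refine le_csSup ?_ (mem_image_of_mem _ ?_)
  · refine (((finite_minDegree_le hb 1).image _).subset (image_mono ?_)).bddAbove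
    exact fun k hk => ⟨hk.1, hk.2.le⟩
  · have hne : weightSpace ρ (a i) ≠ ⊥ := (weightSpace_ne_bot_iff hb _).mpr ⟨_, wt_single a i⟩
    refine ⟨hne, le_antisymm ?_ (Nat.one_le_iff_ne_zero.mpr fun h0 => ?_)⟩
    · simpa using minDegree_le hb (wt_single a i)
    · obtain ⟨α, hα, hd⟩ := exists_degree_eq_minDegree hb hne
      rw [h0, Finsupp.degree_eq_zero_iff] at hd
      rw [hd, wt_zero] at hα
      have := hb.eq_zero_of_wt_eq_zero hρ (Finsupp.single i 1) (by rw [wt_single, hα])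
      simp at this

end Weights

/-! ### Return to the original coordinates -/

section Transfer

variable {r s n : ℕ}

lemma IsWeightBasis.isDiagDomain {ρ : TorusAction r n}
    {b : Module.Basis (Fin n) ℂ (Fin n → ℂ)} {a : Fin n → Fin r → ℤ} (hb : IsWeightBasis ρ b a)
    {D : Set (Fin n → ℂ)} (hD : IsQuasiReinhardtDomain ρ D) (hDb : Bornology.IsBounded D)
    (h0 : 0 ∈ D) : IsDiagDomain a (b.equivFunL '' D) where
  isOpen := b.equivFunL.toHomeomorph.isOpenMap _ hD.isOpen
  isPreconnected := hD.isConnected.isPreconnected.image _ b.equivFunL.continuous.continuousOn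
  zero_mem := ⟨0, h0, map_zero _⟩
  isBounded := (b.equivFunL : (Fin n → ℂ) →L[ℂ] (Fin n → ℂ)).lipschitz.isBounded_image hDb
  invariant := by
    rintro g _ ⟨z, hz, rfl⟩
    exact ⟨act ρ g z, hD.invariant g z hz, hb.equivFun_act g z⟩

/-- Conjugates `f` by weight coordinates on both sides. The free bound `m` serves both claims: the
`i`-th resonance order for single components, and the resonance order for a bound uniform in `i`. -/
theorem exists_polynomial_repr {ρ : TorusAction r n} {ρ' : TorusAction s n}
    (hρ : OnlyConstantInvariants ρ) (hρ' : OnlyConstantInvariants ρ') {D D' : Set (Fin n → ℂ)}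
    (hD : IsQuasiReinhardtDomain ρ D) (hD' : IsQuasiReinhardtDomain ρ' D')
    (hDb : Bornology.IsBounded D) (hDb' : Bornology.IsBounded D') (h0 : 0 ∈ D) (h0' : 0 ∈ D')
    {f : (Fin n → ℂ) → (Fin n → ℂ)} (hf : IsBiholomorphism f D D') (hf0 : f 0 = 0)
    {b' : Module.Basis (Fin n) ℂ (Fin n → ℂ)} {a' : Fin n → Fin s → ℤ}
    (hb' : IsWeightBasis ρ' b' a') (i : Fin n) {m : ℕ} (hm : resonanceOrderAt ρ' a' i ≤ m) :
    ∃ P : MvPolynomial (Fin n) ℂ, P.totalDegree ≤ maxDegreeOfMinLE ρ m ∧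
      ∀ z ∈ D, b'.repr (f z) i = eval z P := by
  obtain ⟨b, a, hb⟩ := exists_isWeightBasis ρ
  obtain ⟨hfd, hfm, F, hFd, hFm, hi⟩ := hf
  have ha := hb.eq_zero_of_wt_eq_zero hρ
  have ha' := hb'.eq_zero_of_wt_eq_zero hρ'
  let e := b.equivFunL
  let e' := b'.equivFunL
  have hmem : ∀ x ∈ e '' D, e.symm x ∈ D := by
    rintro _ ⟨z, hz, rfl⟩; rwa [e.symm_apply_apply]
  have hmem' : ∀ x ∈ e' '' D', e'.symm x ∈ D' := by
    rintro _ ⟨z, hz, rfl⟩; rwa [e'.symm_apply_apply]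
  obtain ⟨S, c, hS, h⟩ := exists_polynomial_component (finite_wt_eq ha) (finite_wt_eq ha') ha ha'
    (hb.isDiagDomain hD hDb h0) (hb'.isDiagDomain hD' hDb' h0')
    (f := fun x => e' (f (e.symm x))) (F := fun y => e (F (e'.symm y)))
    (e'.differentiable.comp_differentiableOn
      (hfd.comp e.symm.differentiable.differentiableOn hmem))
    (e.differentiable.comp_differentiableOn
      (hFd.comp e'.symm.differentiable.differentiableOn hmem'))
    (fun x hx => mem_image_of_mem _ (hfm (hmem x hx)))
    (fun y hy => mem_image_of_mem _ (hFm (hmem' y hy)))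
    ⟨fun x hx => by
      simp only [e'.symm_apply_apply, hi.1 (hmem x hx), e.apply_symm_apply],
      fun y hy => by
      simp only [e.symm_apply_apply, hi.2 (hmem' y hy), e'.apply_symm_apply]⟩
    (by simp only [map_zero, hf0]) i m
    (fun γ hγ => (degree_le_maxDegree hb' hρ' hγ).trans hm)
  refine ⟨bind₁ (linPoly (b.equivFun : (Fin n → ℂ) →ₗ[ℂ] (Fin n → ℂ)))
    (∑ α ∈ S, monomial α (c α)), ?_, fun z hz => ?_⟩
  · refine (totalDegree_bind₁_linPoly_le _ _).trans (totalDegree_finsetSum_le fun α hα => ?_)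
    obtain ⟨β, hβ, hβm⟩ := hS α hα
    exact (totalDegree_monomial_le _ _).trans (degree_le_maxDegreeOfMinLE hb hρ hβ hβm)
  · have h1 := h (e z) (mem_image_of_mem _ hz)
    rw [e.symm_apply_apply] at h1
    rw [eval_bind₁_linPoly, map_sum]
    refine Eq.trans ?_ (h1.trans (Finset.sum_congr rfl fun α _ => ?_))
    · rfl
    · rw [eval_monomial_eq_mono]; rfl

end Transfer

end QuasiReinhardt

end

theorem theorem1p2 {r s n : ℕ}
    (ρ : QuasiReinhardt.TorusAction r n) (ρ' : QuasiReinhardt.TorusAction s n)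
    (hρ : QuasiReinhardt.OnlyConstantInvariants ρ)
    (hρ' : QuasiReinhardt.OnlyConstantInvariants ρ')
    (D D' : Set (Fin n → ℂ))
    (hD : QuasiReinhardt.IsQuasiReinhardtDomain ρ D)
    (hD' : QuasiReinhardt.IsQuasiReinhardtDomain ρ' D')
    (hDb : Bornology.IsBounded D) (hDb' : Bornology.IsBounded D')
    (h0 : (0 : Fin n → ℂ) ∈ D) (h0' : (0 : Fin n → ℂ) ∈ D')
    (f : (Fin n → ℂ) → (Fin n → ℂ))
    (hf : QuasiReinhardt.IsBiholomorphism f D D') (hf0 : f 0 = 0) :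
    -- `f` is polynomial of degree at most the quasi-resonance order of `ρ` and `ρ'`
    (∀ i, ∃ P : MvPolynomial (Fin n) ℂ,
      P.totalDegree ≤ QuasiReinhardt.quasiResonanceOrder ρ ρ' ∧
        ∀ z ∈ D, f z i = MvPolynomial.eval z P) ∧
    -- linear coordinates diagonalizing `ρ'` exist
    (∃ (b : Module.Basis (Fin n) ℂ (Fin n → ℂ)) (a' : Fin n → Fin s → ℤ),
      QuasiReinhardt.IsWeightBasis ρ' b a') ∧
    -- in any such coordinates, the `i`-th component of `f` is a polynomial of degree at most
    -- the `i`-th quasi-resonance order of `ρ` and `ρ'`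
    (∀ (b : Module.Basis (Fin n) ℂ (Fin n → ℂ)) (a' : Fin n → Fin s → ℤ),
      QuasiReinhardt.IsWeightBasis ρ' b a' →
        ∀ i, ∃ P : MvPolynomial (Fin n) ℂ,
          P.totalDegree ≤ QuasiReinhardt.quasiResonanceOrderAt ρ ρ' a' i ∧
            ∀ z ∈ D, b.repr (f z) i = MvPolynomial.eval z P) := by
  obtain ⟨b₀, a₀, hb₀⟩ := QuasiReinhardt.exists_isWeightBasis ρ'
  refine ⟨fun j => ?_, ⟨b₀, a₀, hb₀⟩, fun b' a' hb' i =>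
    QuasiReinhardt.exists_polynomial_repr hρ hρ' hD hD' hDb hDb' h0 h0' hf hf0 hb' i le_rfl⟩
  -- Each standard component is a linear combination of all weight components, so the uniform bound
  -- is needed here.
  choose P hPd hP using fun i =>
    QuasiReinhardt.exists_polynomial_repr hρ hρ' hD hD' hDb hDb' h0 h0' hf hf0 hb₀ i
      (QuasiReinhardt.resonanceOrderAt_le_resonanceOrder hb₀ hρ' i)
  refine ⟨∑ i, MvPolynomial.C (b₀ i j) * P i, ?_, fun z hz => ?_⟩
  · refine MvPolynomial.totalDegree_finsetSum_le fun i _ => ?_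
    refine (MvPolynomial.totalDegree_mul _ _).trans ?_
    rw [MvPolynomial.totalDegree_C, zero_add]
    exact hPd i
  · conv_lhs => rw [← b₀.sum_repr (f z)]
    simp [← hP _ z hz, mul_comm]
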